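/- For positive integers $m$ and $n$, let $\Delta^m_n$ be the simple graph with vertices $e_i$ $(1\le i\le n)$ and $f_i^k$ $(1\le i\le n-1,\ 1\le k\le m)$ whose edges are $\{f_i^k,f_{i+1}^k\}$ $(1\le i\le n-2,\ 1\le k\le m)$ and $\{e_i,f_i^k\}$, $\{f_i^k,e_{i+1}\}$ $(1\le i\le n-1,\ 1\le k\le m)$. The independence complex $I(G)$ of a graph $G$ is the simplicial complex whose simplices are the independent sets of $G$, and the matching complex $M(G)$ is the simplicial complex on the edge set of $G$ whose simplices are the matchings of $G$. Let $\Gamma_n$ be the $n\times 2$ grid graph, with vertices $(i,j)\in\mathbb Z^2$, $1\le i\le n$, $1\le j\le 2$, where $(i,j)$ and $(i',j')$ are adjacent if and only if $|i'-i|+|j'-j|=1$. A wedge of spheres means a wedge of finitely many spheres $S^{d}$ with $d\ge 0$; the empty wedge is a point. Then: (1) For all $m\ge 2$ and $n\ge 1$, the geometric realization of $I(\Delta^m_n)$ is homotopy equivalent to a wedge of spheres, and all the simplicial homology groups $H_q(I(\Delta^m_n);\mathbb Z)$, $q\ge 0$, are torsion-free. (2) In particular, for all $n\ge 1$, the geometric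 realization of the matching complex $M(\Gamma_n)$ is homotopy equivalent to a wedge of spheres, and all the simplicial homology groups $H_q(M(\Gamma_n);\mathbb Z)$, $q\ge 0$, are torsion-free. -/

import Mathlib

open scoped ContinuousMap

/-! ### Simplicial complexes: independence complexes and matching complexes -/

/-- The independence complex `I(G)` of a simple graph `G`: the (nonempty) simplices are the
nonempty finite independent sets of vertices of `G`. -/
def SimpleGraph.independenceComplex {V : Type} (G : SimpleGraph V) :
    AbstractSimplicialComplex V where
  faces := {s | s.Nonempty ∧ G.IsIndepSet (s : Set V)}
  isRelLowerSet_faces := fun {_} hs =>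
    ⟨hs.1, fun _ hts ht => ⟨ht, hs.2.mono (Finset.coe_subset.mpr hts)⟩⟩
  singleton_mem := fun v => ⟨Finset.singleton_nonempty v, by simp [SimpleGraph.IsIndepSet]⟩

/-- A set `s` of edges of `G` is a matching if every vertex of `G` is an endpoint of at most one
edge in `s`, i.e. the subgraph with edge set `s` has maximal degree at most `1`. -/
def SimpleGraph.IsEdgeMatching {V : Type} (G : SimpleGraph V) (s : Set G.edgeSet) : Prop :=
  ∀ v : V, {e ∈ s | v ∈ (e : Sym2 V)}.Subsingleton

/-- The matching complex `M(G)` of a simple graph `G`: its vertices are the edges of `G`, its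
(nonempty) simplices are the nonempty finite matchings. -/
def SimpleGraph.matchingComplex {V : Type} (G : SimpleGraph V) :
    AbstractSimplicialComplex G.edgeSet where
  faces := {s | s.Nonempty ∧ G.IsEdgeMatching (s : Set G.edgeSet)}
  isRelLowerSet_faces := fun {_} hs =>
    ⟨hs.1, fun _ hts ht => ⟨ht, fun v => (hs.2 v).anti fun _ he =>
      ⟨Finset.coe_subset.mpr hts he.1, he.2⟩⟩⟩
  singleton_mem := fun e => ⟨Finset.singleton_nonempty e, fun v a ha b hb => by
    have h1 : a = e := by simpa using ha.1
    have h2 : b = e := by simpa using hb.1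
    rw [h1, h2]⟩

/-! ### Topology and homology of a simplicial complex -/

/-- The geometric realization of a simplicial complex with finite vertex set `V`: the points of
`ℝ^V` with nonnegative barycentric coordinates which are supported in a simplex and have sum `1`.
It carries the subspace topology of `ℝ^V`. -/
def AbstractSimplicialComplex.realization {V : Type} [Finite V]
    (K : AbstractSimplicialComplex V) : Set (V → ℝ) :=
  {x | (∀ v, 0 ≤ x v) ∧ ∃ s ∈ K.faces, (∀ v, v ∉ s → x v = 0) ∧ ∑ v ∈ s, x v = 1}

/-- The simplicial set of ordered simplices of a simplicial complex `K`: its `q`-simplices are the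
tuples `(v₀, …, v_q)` of vertices, possibly with repetitions, that lie in a common simplex. -/
def AbstractSimplicialComplex.orderedSimplices {V : Type}
    (K : AbstractSimplicialComplex V) : SSet.{0} where
  obj q := {f : Fin (q.unop.len + 1) → V // ∃ s ∈ K.faces, ∀ i, f i ∈ s}
  map φ := TypeCat.ofHom fun f => ⟨fun i => f.1 (φ.unop.toOrderHom i), by
    obtain ⟨s, hs, h⟩ := f.2
    exact ⟨s, hs, fun i => h _⟩⟩

/-- The `q`-th simplicial homology group `H_q(K; ℤ)` of a simplicial complex `K`, i.e. the homology
of the chain complex whose `q`-th group is free on the ordered simplices `(v₀, …, v_q)`, with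
boundary `∑ (-1)^i (v₀, …, v̂ᵢ, …, v_q)`. -/
noncomputable def AbstractSimplicialComplex.integralHomology {V : Type}
    (K : AbstractSimplicialComplex V) (q : ℕ) : ModuleCat.{0} ℤ :=
  K.orderedSimplices.homology (ModuleCat.of ℤ ℤ) q

/-! ### Wedges of spheres -/

/-- The relation on the disjoint union of a point and of the `X i` that identifies the point with
each of the base points `x i`. -/
inductive WedgeRel {ι : Type} (X : ι → Type) (x : ∀ i, X i) : Unit ⊕ (Σ i, X i) →
    Unit ⊕ (Σ i, X i) → Prop
  | basePoint (i : ι) : WedgeRel X x (Sum.inl ()) (Sum.inr ⟨i, x i⟩)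

/-- The wedge sum of the pointed spaces `(X i, x i)`; the empty wedge is a point. -/
def Wedge {ι : Type} (X : ι → Type) (x : ∀ i, X i) : Type :=
  Quot (WedgeRel X x)

instance Wedge.instTopologicalSpace {ι : Type} (X : ι → Type) (x : ∀ i, X i)
    [∀ i, TopologicalSpace (X i)] : TopologicalSpace (Wedge X x) :=
  inferInstanceAs (TopologicalSpace (Quot (WedgeRel X x)))

/-- The standard sphere `S^d`, the unit sphere of `ℝ^(d+1)`. -/
abbrev StdSphere (d : ℕ) : Type :=
  Metric.sphere (0 : EuclideanSpace ℝ (Fin (d + 1))) 1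

/-- The base point `(1, 0, …, 0)` of `S^d`. -/
noncomputable def StdSphere.basePoint (d : ℕ) : StdSphere d :=
  ⟨EuclideanSpace.single 0 1, by simp⟩

/-- The space `Y` is homotopy equivalent to a wedge of finitely many spheres `S^(d 0) ∨ … ∨
S^(d (k-1))`, where `k = 0` is allowed and means that `Y` is contractible. -/
def IsHomotopyWedgeOfSpheres (Y : Type) [TopologicalSpace Y] : Prop :=
  ∃ (k : ℕ) (d : Fin k → ℕ),
    Nonempty (Y ≃ₕ Wedge (fun i => StdSphere (d i)) (fun i => StdSphere.basePoint (d i)))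

/-! ### The graphs -/

/-- The graph `Δ^m_n`. The vertex `Sum.inl i` is `e_{i+1}`, and `Sum.inr (i, k)` is `f_{i+1}^{k+1}`.
The edges are `e_i ~ f_i^k ~ e_{i+1}` and `f_i^k ~ f_{i+1}^k`. -/
def deltaGraph (m n : ℕ) : SimpleGraph (Fin n ⊕ (Fin (n - 1) × Fin m)) where
  Adj
    | Sum.inl _, Sum.inl _ => False
    | Sum.inl j, Sum.inr (i, _) => (j : ℕ) = i ∨ (j : ℕ) = i + 1
    | Sum.inr (i, _), Sum.inl j => (j : ℕ) = i ∨ (j : ℕ) = i + 1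
    | Sum.inr (i, k), Sum.inr (j, l) => k = l ∧ ((j : ℕ) = i + 1 ∨ (i : ℕ) = j + 1)
  symm := ⟨by
    rintro (a | ⟨a, k⟩) (b | ⟨b, l⟩) h
    · exact h
    · exact h
    · exact h
    · exact ⟨h.1.symm, h.2.symm⟩⟩
  loopless := ⟨by
    rintro (a | ⟨a, k⟩) h
    · exact h
    · have := h.2
      omega⟩

/-- The `(m × n)`-grid graph `Γ(m, n)`, with coordinates numbered from `0`. -/
def gridGraph (m n : ℕ) : SimpleGraph (Fin m × Fin n) where
  Adj p q := |((q.1 : ℕ) : ℤ) - ((p.1 : ℕ) : ℤ)| + |((q.2 : ℕ) : ℤ) - ((p.2 : ℕ) : ℤ)| = 1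
  symm := ⟨fun p q h => by
    rw [abs_sub_comm ((p.1 : ℕ) : ℤ), abs_sub_comm ((p.2 : ℕ) : ℤ)]
    exact h⟩
  loopless := ⟨fun p h => by simp at h⟩

/-! Deleting a vertex `v` exhibits an independence complex as the mapping cone of the inclusion of
the link of `v` into the deletion of `v` (`coneHomeomorph`). If link and deletion are wedges of
spheres, the deletion is path connected and the inclusion is null-homotopic, then the complex is the
wedge of the deletion with the suspended link (`IsHomotopySphereWedge.mCone`). If the inclusion also
kills reduced homology, the reduced homology of the whole is an extension of that of the link by
that of the deletion, so torsion-freeness passes on (`IndepTorsionFree.of_link`). The homology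
statement is not derived from the homotopy type: `IndepGood` and `IndepNull` carry both halves
through the same induction.

Two simplifications feed it. A vertex `v` whose neighbourhood contains that of some `u` can be
removed, by sliding its mass to `u` (`IndepGood.of_dominated`). An isolated edge amounts to a
suspension (`IndepGood.of_edge`).

For the graph `Δ`, numbered from 0, the induction runs downwards over the tails, spanned by all
vertices of index at least `i` (`good_tail`). In such a tail `e_{i+1}` is dominated by `e_i`, and is
dropped. The link of `e_{i+2}` is then a suspension of the tail from `i+3`. In the deletion of
`e_{i+2}` one removes `e_i`; what is left is an `m`-fold suspension of the tail from `i+3`, while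
the link of `e_i` is, away from the end of the graph, an `m`-fold suspension of the tail from `i+4`.
Both link inclusions are null (`null_star`, `null_link`). The assumption `m ≥ 2` gives
connectedness, and a second strand `k` to contract along in `null_star`.

The matching complex is covered by `m = 2`, because `Δ^2_n` is the line graph of the ladder
(`GridGraph.edgeEquiv`). -/

open scoped unitInterval Topology

/-! ### Mapping cones -/

/-- The relation on `X ⊕ (L × I) ⊕ pt` defining the mapping cone of `f : L → X`. -/
inductive MConeRel {L X : Type} (f : L → X) : X ⊕ (L × I) ⊕ Unit → X ⊕ (L × I) ⊕ Unit → Prop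
  | zero (l : L) : MConeRel f (Sum.inl (f l)) (Sum.inr (Sum.inl (l, 0)))
  | one (l : L) : MConeRel f (Sum.inr (Sum.inr ())) (Sum.inr (Sum.inl (l, 1)))

/-- The mapping cone of `f`: the cone `L × I / L × 1` attached to `X` along `f`. -/
def MCone {L X : Type} (f : L → X) : Type := Quot (MConeRel f)

namespace MCone

variable {L X Z : Type} [TopologicalSpace L] [TopologicalSpace X] [TopologicalSpace Z]

instance (f : L → X) : TopologicalSpace (MCone f) :=
  inferInstanceAs (TopologicalSpace (Quot (MConeRel f)))

instance (f : L → X) [CompactSpace L] [CompactSpace X] : CompactSpace (MCone f) :=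
  inferInstanceAs (CompactSpace (Quot (MConeRel f)))

/-- The inclusion of the target in the mapping cone. -/
def inl (f : L → X) : C(X, MCone f) :=
  ⟨fun x => Quot.mk _ (Sum.inl x), continuous_quot_mk.comp continuous_inl⟩

/-- The map from the cylinder to the mapping cone. -/
def cyl (f : L → X) : C(L × I, MCone f) :=
  ⟨fun x => Quot.mk _ (Sum.inr (Sum.inl x)),
    continuous_quot_mk.comp (continuous_inr.comp continuous_inl)⟩

/-- The apex of the mapping cone. -/
def apex (f : L → X) : MCone f := Quot.mk _ (Sum.inr (Sum.inr ()))

@[simp] lemma cyl_zero (f : L → X) (l : L) : cyl f (l, 0) = inl f (f l) :=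
  (Quot.sound (MConeRel.zero l)).symm

@[simp] lemma cyl_one (f : L → X) (l : L) : cyl f (l, 1) = apex f :=
  (Quot.sound (MConeRel.one l)).symm

lemma ind {f : L → X} {p : MCone f → Prop} (h1 : ∀ x, p (inl f x)) (h2 : ∀ l t, p (cyl f (l, t)))
    (h3 : p (apex f)) (y : MCone f) : p y := by
  induction y using Quot.ind with
  | mk y =>
    rcases y with x | ⟨l, t⟩ | ⟨⟩
    · exact h1 x
    · exact h2 l t
    · exact h3

/-- The map out of a mapping cone. -/
def lift (f : L → X) (b : C(X, Z)) (N : C(L × I, Z)) (z : Z) (h0 : ∀ l, N (l, 0) = b (f l))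
    (h1 : ∀ l, N (l, 1) = z) : C(MCone f, Z) where
  toFun := Quot.lift (Sum.elim b (Sum.elim N fun _ => z)) (by
    rintro _ _ (l | l)
    · exact (h0 l).symm
    · exact (h1 l).symm)
  continuous_toFun := continuous_quot_lift _ (by fun_prop)

section
variable (f : L → X) (b : C(X, Z)) (N : C(L × I, Z)) (z : Z) (h0 : ∀ l, N (l, 0) = b (f l))
    (h1 : ∀ l, N (l, 1) = z)
@[simp] lemma lift_inl (x : X) : lift f b N z h0 h1 (inl f x) = b x := rfl
@[simp] lemma lift_cyl (x : L × I) : lift f b N z h0 h1 (cyl f x) = N x := rfl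
end

/-- Two maps out of a mapping cone are homotopic if their restrictions are compatibly homotopic. -/
lemma homotopic_of (f : L → X) {F₀ F₁ : C(MCone f, Z)} (B : C(X × I, Z)) (N : C((L × I) × I, Z))
    (z : C(I, Z)) (h0 : ∀ l s, N ((l, 0), s) = B (f l, s)) (h1 : ∀ l s, N ((l, 1), s) = z s)
    (hB0 : ∀ x, F₀ (inl f x) = B (x, 0)) (hB1 : ∀ x, F₁ (inl f x) = B (x, 1))
    (hN0 : ∀ y, F₀ (cyl f y) = N (y, 0)) (hN1 : ∀ y, F₁ (cyl f y) = N (y, 1))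
    (hz0 : F₀ (apex f) = z 0) (hz1 : F₁ (apex f) = z 1) : F₀.Homotopic F₁ := by
  -- Currying the time parameter gives a map from the cone to `C(I, Z)`, so no product of a quotient
  -- map with `I` has to be analysed.
  let F := lift f B.curry N.curry z (fun l => by ext s; exact h0 l s)
    (fun l => by ext s; exact h1 l s)
  refine ⟨⟨⟨fun p => F p.2 p.1, ?_⟩, ?_, ?_⟩⟩
  · exact continuous_eval.comp (by fun_prop : Continuous fun p : I × MCone f => (F p.2, p.1))
  · exact ind (fun x => (hB0 x).symm) (fun l t => (hN0 (l, t)).symm) hz0.symm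
  · exact ind (fun x => (hB1 x).symm) (fun l t => (hN1 (l, t)).symm) hz1.symm

lemma hom_ext {f : L → X} {F₀ F₁ : C(MCone f, Z)} (h1 : ∀ x, F₀ (inl f x) = F₁ (inl f x))
    (h2 : ∀ l t, F₀ (cyl f (l, t)) = F₁ (cyl f (l, t))) (h3 : F₀ (apex f) = F₁ (apex f)) :
    F₀ = F₁ := ContinuousMap.ext (ind h1 h2 h3)

section Path

/-- The map out of the mapping cone of `f` given by a map `b` on the target and a path in the
function space from `b ∘ f` to a constant map. -/
def mapP [CompactSpace L] [T2Space L] {f : C(L, X)} (b : C(X, Z)) {g : C(L, Z)} (hg : g = b.comp f) {z : Z}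
    (P : Path g (ContinuousMap.const L z)) : C(MCone f, Z) :=
  lift f b ⟨fun x => P x.2 x.1, continuous_eval.comp
      (by fun_prop : Continuous fun x : L × I => (P x.2, x.1))⟩ z
    (fun l => by subst hg; simp) (fun l => by simp)

/-- The path in `C(L, MCone f)` which contracts the image of `L` to the apex. -/
def conePath (f : C(L, X)) :
    Path ((inl f).comp f) (ContinuousMap.const L (apex f)) where
  toFun t := ((cyl f).comp ⟨Prod.swap, continuous_swap⟩).curry t
  continuous_toFun := map_continuous _
  source' := by ext l; exact cyl_zero (f : L → X) l
  target' := by ext l; exact cyl_one (f : L → X) l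

lemma mapP_conePath [CompactSpace L] [T2Space L] (f : C(L, X)) : mapP (inl f) rfl (conePath f) = ContinuousMap.id _ :=
  hom_ext (fun _ => rfl) (fun _ _ => rfl) rfl

lemma mapP_homotopic [CompactSpace L] [T2Space L] {f : C(L, X)} (b : C(X, Z)) {g : C(L, Z)} (hg : g = b.comp f) {z : Z}
    {P Q : Path g (ContinuousMap.const L z)} (h : P.Homotopic Q) :
    (mapP b hg P).Homotopic (mapP b hg Q) := by
  obtain ⟨H⟩ := h
  refine homotopic_of f ⟨fun x => b x.1, by fun_prop⟩
    ⟨fun x => H (x.2, x.1.2) x.1.1, continuous_eval.comp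
      (by fun_prop : Continuous fun x : (L × I) × I => (H (x.2, x.1.2), x.1.1))⟩
    (.const _ z) ?_ ?_ (fun _ => rfl) (fun _ => rfl) ?_ ?_ rfl rfl
  · intro l s; subst hg; simp
  · intro l s; simp
  · rintro ⟨l, t⟩; simp [mapP]
  · rintro ⟨l, t⟩; simp [mapP]

lemma comp_mapP [CompactSpace L] [T2Space L] {Z' : Type} [TopologicalSpace Z'] (h : C(Z, Z')) {f : C(L, X)} (b : C(X, Z))
    {g : C(L, Z)} (hg : g = b.comp f) {z : Z} (P : Path g (ContinuousMap.const L z)) :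
    h.comp (mapP b hg P) = mapP (h.comp b) (g := h.comp g) (by subst hg; rfl) (z := h z)
      (P.map (f := fun u => h.comp u) (by fun_prop)) :=
  hom_ext (fun _ => rfl) (fun _ _ => rfl) rfl

/-- The trace of a homotopy as a path in the function space. -/
def tracePath {b b' : C(X, Z)} (G : b.Homotopy b') (f : C(L, X)) :
    Path (b.comp f) (b'.comp f) where
  toFun t := (G.toContinuousMap.comp ((ContinuousMap.id I).prodMap f)).curry t
  continuous_toFun := map_continuous _
  source' := by ext l; simp
  target' := by ext l; simp

lemma tracePath_apply {b b' : C(X, Z)} (G : b.Homotopy b') (f : C(L, X)) (t : I) (l : L) :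
    tracePath G f t l = G (t, f l) := rfl

/-- While `G` moves the target from `b` to `b'`, the collar that traverses `G` only needs the
remaining part of `G`, and finally is constant in front of `P`. -/
lemma mapP_shift [CompactSpace L] [T2Space L] {f : C(L, X)} {b b' : C(X, Z)} (G : b.Homotopy b') {z : Z}
    (P : Path (b'.comp f) (ContinuousMap.const L z)) :
    (mapP b rfl ((tracePath G f).trans P)).Homotopic (mapP b' rfl P) := by
  let R : Path (b'.comp f) (ContinuousMap.const L z) := (Path.refl _).trans P
  refine ContinuousMap.Homotopic.trans (g := mapP b' rfl R) ?_
    (mapP_homotopic _ _ ⟨Path.Homotopy.reflTrans P⟩)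
  -- The time `s + u - s * u` runs from `s` at `u = 0` to `1` at `u = 1`; it is `u` for `s = 0` and
  -- constantly `1` for `s = 1`.
  have hsym : ∀ x : I × I, (x.1 : ℝ) + x.2 - x.1 * x.2 ∈ I := by
    rintro ⟨⟨a, ha⟩, b, hb⟩
    constructor <;> simp only <;> nlinarith [ha.1, ha.2, hb.1, hb.2]
  let N : (L × I) × I → Z := fun x => if (x.1.2 : ℝ) ≤ 1 / 2 then
    G (⟨_, hsym (x.2, Set.projIcc 0 1 zero_le_one (2 * x.1.2))⟩, f x.1.1)
    else P (Set.projIcc 0 1 zero_le_one (2 * x.1.2 - 1)) x.1.1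
  have hN : Continuous N := by
    refine Continuous.if_le ?_ ?_ (by fun_prop) (by fun_prop) ?_
    · refine G.continuous.comp (Continuous.prodMk (Continuous.subtype_mk ?_ _) (by fun_prop))
      fun_prop
    · exact continuous_eval.comp (by fun_prop : Continuous fun x : (L × I) × I =>
        (P (Set.projIcc 0 1 zero_le_one (2 * x.1.2 - 1)), x.1.1))
    · rintro ⟨⟨l, t⟩, s⟩ h
      have h : (t : ℝ) = 1 / 2 := h
      simp [h]
  refine homotopic_of f ⟨fun x => G (x.2, x.1), by fun_prop⟩ ⟨N, hN⟩ (.const _ z) ?_ ?_ ?_ ?_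
    ?_ ?_ rfl rfl
  · intro l s; simp [N]
  · intro l s; simp [N]; norm_num
  · intro x; simp [mapP]
  · intro x; simp [mapP]
  · rintro ⟨l, t⟩
    simp only [mapP, lift_cyl, ContinuousMap.coe_mk, N, Path.trans_apply]
    split_ifs with h
    · rw [tracePath_apply]
      congr 2; ext; simp [Set.projIcc_of_mem zero_le_one (show (2 * (t : ℝ)) ∈ Set.Icc 0 1 from ⟨by linarith [t.2.1], by linarith⟩)]
    · rw [Set.projIcc_of_mem zero_le_one (show (2 * (t : ℝ) - 1) ∈ Set.Icc 0 1 from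
        ⟨by linarith, by linarith [t.2.2]⟩)]
  · rintro ⟨l, t⟩
    simp only [mapP, lift_cyl, ContinuousMap.coe_mk, N, R, Path.trans_apply]
    split_ifs with h
    · simp
    · rw [Set.projIcc_of_mem zero_le_one (show (2 * (t : ℝ) - 1) ∈ Set.Icc 0 1 from
        ⟨by linarith, by linarith [t.2.2]⟩)]

end Path
end MCone

/-! ### Homotopy invariance of mapping cones -/

namespace MCone

variable {L X Z : Type} [TopologicalSpace L] [TopologicalSpace X] [TopologicalSpace Z]

section

variable [CompactSpace L] [T2Space L]

/-- The comparison map of the mapping cones of two maps joined by a path. -/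
noncomputable def shiftMap {f g : C(L, X)} (γ : Path f g) : C(MCone f, MCone g) :=
  mapP (inl g) rfl ((γ.map (f := fun u => (inl g).comp u) (by fun_prop)).trans (conePath g))

/-- The composite is the cone map along `γ⁻¹ · γ · conePath`, and `γ⁻¹ · γ` contracts with fixed
ends. -/
lemma shiftMap_comp_symm {f g : C(L, X)} (γ : Path f g) :
    ((shiftMap γ).comp (shiftMap γ.symm)).Homotopic (ContinuousMap.id _) := by
  rw [← mapP_conePath g, shiftMap.eq_1 γ.symm, comp_mapP]
  let p := γ.map (f := fun u => (inl g).comp u) (by fun_prop)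
  have h1 : ((γ.symm.map (f := fun u => (inl f).comp u) (by fun_prop)).trans (conePath f)).map
      (f := fun u => (shiftMap γ).comp u) (by fun_prop) =
      (p.symm.trans (p.trans (conePath g)) : Path ((inl g).comp g) (.const L (apex g))) := by
    rw [Path.map_trans]
    rfl
  rw [h1]
  refine mapP_homotopic (inl g) _ ?_
  have e1 : (p.symm.trans (p.trans (conePath g))).Homotopic
      ((p.symm.trans p).trans (conePath g)) := ⟨(Path.Homotopy.transAssoc _ _ _).symm⟩
  have e2 : (p.symm.trans p).Homotopic (Path.refl _) := ⟨(Path.Homotopy.reflSymmTrans p).symm⟩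
  have e3 : ((p.symm.trans p).trans (conePath g)).Homotopic ((Path.refl _).trans (conePath g)) :=
    e2.hcomp (Path.Homotopic.refl _)
  exact e1.trans (e3.trans ⟨Path.Homotopy.reflTrans _⟩)

/-- Homotopic maps have homotopy equivalent mapping cones. -/
noncomputable def shiftEquiv {f g : C(L, X)} (γ : Path f g) : MCone f ≃ₕ MCone g where
  toFun := shiftMap γ
  invFun := shiftMap γ.symm
  left_inv := by simpa using shiftMap_comp_symm γ.symm
  right_inv := shiftMap_comp_symm γ

/-- The map of mapping cones induced by a map `β` of the targets. -/
def mapTarget (f : C(L, X)) (β : C(X, Z)) : C(MCone f, MCone (β.comp f)) :=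
  mapP ((inl (β.comp f)).comp β) rfl (conePath (β.comp f))

/-- The composite of the two induced maps lands in the cone of `β' ∘ β ∘ f`; shifting along the
trace of the homotopy `β' ∘ β ≃ id` brings it back to the cone of `f`. This yields a one-sided
inverse only. -/
lemma exists_leftInverse_mapTarget (f : C(L, X)) (β : C(X, Z)) (β' : C(Z, X))
    (h : (β'.comp β).Homotopic (ContinuousMap.id X)) :
    ∃ T : MCone (β'.comp (β.comp f)) ≃ₕ MCone f,
      ((T.toFun.comp (mapTarget (β.comp f) β')).comp (mapTarget f β)).Homotopic
        (ContinuousMap.id _) := by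
  obtain ⟨G⟩ := h
  refine ⟨shiftEquiv (tracePath G f), ?_⟩
  let G' : ((inl f).comp (β'.comp β)).Homotopy (inl f) :=
    (ContinuousMap.Homotopy.refl (inl f)).comp G
  have h2 := mapP_shift G' (conePath f)
  rw [mapP_conePath] at h2
  convert h2 using 1
  exact hom_ext (fun _ => rfl) (fun _ _ => rfl) rfl

/-- A homotopy equivalence of the targets induces a homotopy equivalence of mapping cones. -/
lemma nonempty_homotopyEquiv_target (f : C(L, X)) (e : X ≃ₕ Z) :
    Nonempty (MCone f ≃ₕ MCone (e.toFun.comp f)) := by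
  obtain ⟨T, hT⟩ := exists_leftInverse_mapTarget f e.toFun e.invFun e.left_inv
  obtain ⟨T', hT'⟩ := exists_leftInverse_mapTarget (e.toFun.comp f) e.invFun e.toFun e.right_inv
  set Φ := mapTarget f e.toFun
  set Ψ := mapTarget (e.toFun.comp f) e.invFun
  set U := T'.toFun.comp (mapTarget (e.invFun.comp (e.toFun.comp f)) e.toFun)
  -- `Ψ ∘ Φ ∘ T ≃ id`
  have h1 : ((Ψ.comp Φ).comp T.toFun).Homotopic (ContinuousMap.id _) := by
    have a : (T.invFun.comp (((T.toFun.comp Ψ).comp Φ).comp T.toFun)).Homotopic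
        (T.invFun.comp ((ContinuousMap.id _).comp T.toFun)) :=
      (ContinuousMap.Homotopic.refl _).comp (hT.comp (ContinuousMap.Homotopic.refl _))
    have b : ((T.invFun.comp T.toFun).comp ((Ψ.comp Φ).comp T.toFun)).Homotopic
        ((ContinuousMap.id _).comp ((Ψ.comp Φ).comp T.toFun)) :=
      T.left_inv.comp (ContinuousMap.Homotopic.refl _)
    exact b.symm.trans (a.trans T.left_inv)
  -- `Ψ` has the left inverse `U` and the right inverse `Φ ∘ T`, so these agree up to homotopy and
  -- `Φ ∘ T` is a two-sided inverse of `Ψ`.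
  have h2 : U.Homotopic (Φ.comp T.toFun) := by
    have a : (U.comp ((Ψ.comp Φ).comp T.toFun)).Homotopic (U.comp (ContinuousMap.id _)) :=
      (ContinuousMap.Homotopic.refl _).comp h1
    have b : ((U.comp Ψ).comp (Φ.comp T.toFun)).Homotopic
        ((ContinuousMap.id _).comp (Φ.comp T.toFun)) :=
      hT'.comp (ContinuousMap.Homotopic.refl _)
    exact a.symm.trans b
  have h3 : ((Φ.comp T.toFun).comp Ψ).Homotopic (ContinuousMap.id _) :=
    (h2.symm.comp (ContinuousMap.Homotopic.refl Ψ)).trans hT'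
  exact ⟨⟨Φ, T.toFun.comp Ψ, hT, h3⟩⟩

end

/-- The map of mapping cones of constant maps induced by a map of the sources. -/
def mapSource {L' : Type} [TopologicalSpace L'] (x : X) (α : C(L, L')) :
    C(MCone (ContinuousMap.const L x), MCone (ContinuousMap.const L' x)) :=
  lift _ (inl _) ((cyl _).comp (α.prodMap (ContinuousMap.id I))) (apex _)
    (fun _ => cyl_zero _ _) (fun _ => cyl_one _ _)

lemma mapSource_comp_homotopic {L' : Type} [TopologicalSpace L'] (x : X) (α : C(L, L'))
    (β : C(L', L)) (h : (β.comp α).Homotopic (ContinuousMap.id L)) :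
    ((mapSource x β).comp (mapSource x α)).Homotopic (ContinuousMap.id _) := by
  obtain ⟨H⟩ := h
  refine homotopic_of _ ⟨fun y => inl _ y.1, by fun_prop⟩
    ⟨fun y => cyl _ (H (y.2, y.1.1), y.1.2), by fun_prop⟩ (.const _ (apex _)) ?_ ?_
    (fun _ => rfl) (fun _ => rfl) ?_ ?_ rfl rfl
  · exact fun _ _ => cyl_zero _ _
  · exact fun _ _ => cyl_one _ _
  · intro y
    exact congrArg (fun l => cyl _ (l, y.2)) (H.apply_zero y.1).symm
  · intro y
    exact congrArg (fun l => cyl _ (l, y.2)) (H.apply_one y.1).symm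

/-- Homotopy equivalent sources give homotopy equivalent mapping cones of constant maps. -/
def sourceEquiv {L' : Type} [TopologicalSpace L'] (x : X) (e : L ≃ₕ L') :
    MCone (ContinuousMap.const L x) ≃ₕ MCone (ContinuousMap.const L' x) where
  toFun := mapSource x e.toFun
  invFun := mapSource x e.invFun
  left_inv := mapSource_comp_homotopic x _ _ e.left_inv
  right_inv := mapSource_comp_homotopic x _ _ e.right_inv

end MCone

/-! ### Maps and homotopies out of wedges -/

namespace Wedge

variable {ι : Type} {X : ι → Type} {x : ∀ i, X i} [∀ i, TopologicalSpace (X i)]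
  {Z : Type} [TopologicalSpace Z]

/-- The base point of a wedge. -/
def base (X : ι → Type) (x : ∀ i, X i) : Wedge X x := Quot.mk _ (Sum.inl ())

/-- The inclusion of a summand in a wedge. -/
def incl (x : ∀ i, X i) (i : ι) : C(X i, Wedge X x) where
  toFun y := Quot.mk _ (Sum.inr ⟨i, y⟩)
  continuous_toFun := continuous_quot_mk.comp (continuous_inr.comp continuous_sigmaMk)

@[simp] lemma incl_base (x : ∀ i, X i) (i : ι) : incl x i (x i) = base X x :=
  (Quot.sound (WedgeRel.basePoint i)).symm

lemma ind {p : Wedge X x → Prop} (h0 : p (base X x)) (h : ∀ i y, p (incl x i y))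
    (w : Wedge X x) : p w := by
  induction w using Quot.ind with
  | mk w =>
    rcases w with ⟨⟩ | ⟨i, y⟩
    · exact h0
    · exact h i y

/-- The map out of a wedge. -/
def lift (x : ∀ i, X i) (g : ∀ i, C(X i, Z)) (z : Z) (h : ∀ i, g i (x i) = z) :
    C(Wedge X x, Z) where
  toFun := Quot.lift (Sum.elim (fun _ => z) fun y => g y.1 y.2) (by
    rintro _ _ ⟨i⟩
    exact (h i).symm)
  continuous_toFun := continuous_quot_lift _ (by
    refine continuous_const.sumElim (continuous_sigma fun i => (g i).continuous))

lemma hom_ext {F₀ F₁ : C(Wedge X x, Z)} (h0 : F₀ (base X x) = F₁ (base X x))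
    (h : ∀ i y, F₀ (incl x i y) = F₁ (incl x i y)) : F₀ = F₁ :=
  ContinuousMap.ext (ind h0 h)

lemma homotopic_of {F₀ F₁ : C(Wedge X x, Z)} (g : ∀ i, C(X i × I, Z)) (z : C(I, Z))
    (h : ∀ i s, g i (x i, s) = z s) (hz0 : F₀ (base X x) = z 0) (hz1 : F₁ (base X x) = z 1)
    (h0 : ∀ i y, F₀ (incl x i y) = g i (y, 0)) (h1 : ∀ i y, F₁ (incl x i y) = g i (y, 1)) :
    F₀.Homotopic F₁ := by
  let F := lift x (fun i => (g i).curry) z (fun i => by ext s; exact h i s)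
  refine ⟨⟨⟨fun p => F p.2 p.1, ?_⟩, ?_, ?_⟩⟩
  · exact continuous_eval.comp (by fun_prop : Continuous fun p : I × Wedge X x => (F p.2, p.1))
  · exact ind hz0.symm (fun i y => (h0 i y).symm)
  · exact ind hz1.symm (fun i y => (h1 i y).symm)

end Wedge

/-! ### Wedges of spheres -/

/-- The wedge of the spheres `S^(d i)`. -/
abbrev SphereWedge {ι : Type} (d : ι → ℕ) : Type :=
  Wedge (fun i => StdSphere (d i)) (fun i => StdSphere.basePoint (d i))

namespace StdSphere

lemma sum_sq {d : ℕ} (x : StdSphere d) : ∑ i, (x.1 i) ^ 2 = 1 := by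
  have h := EuclideanSpace.real_norm_sq_eq x.1
  rw [← h, norm_eq_of_mem_sphere x]; norm_num

/-- A point of the sphere given by its coordinates. -/
def ofSumSq {d : ℕ} (v : Fin (d + 1) → ℝ) (h : ∑ i, v i ^ 2 = 1) : StdSphere d :=
  ⟨WithLp.toLp 2 v, by
    rw [mem_sphere_zero_iff_norm, ← sq_eq_sq₀ (norm_nonneg _) zero_le_one,
      EuclideanSpace.real_norm_sq_eq]
    simpa using h⟩

@[simp] lemma ofSumSq_apply {d : ℕ} (v : Fin (d + 1) → ℝ) (h : ∑ i, v i ^ 2 = 1) (i : Fin (d + 1)) :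
    (ofSumSq v h).1 i = v i := rfl

lemma ext' {d : ℕ} {x y : StdSphere d} (h : ∀ i, x.1 i = y.1 i) : x = y :=
  Subtype.ext (by ext i; exact h i)

lemma continuous_ofSumSq {T : Type} [TopologicalSpace T] {d : ℕ} {v : T → Fin (d + 1) → ℝ}
    (h : ∀ t, ∑ i, v t i ^ 2 = 1) (hv : Continuous v) :
    Continuous fun t => ofSumSq (v t) (h t) :=
  Continuous.subtype_mk ((PiLp.continuous_toLp 2 _).comp hv) _

lemma continuous_apply {d : ℕ} (i : Fin (d + 1)) : Continuous fun x : StdSphere d => x.1 i := by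
  fun_prop

@[simp] lemma basePoint_zero (d : ℕ) : (basePoint d).1 0 = 1 := by simp [basePoint]

@[simp] lemma basePoint_succ (d : ℕ) (i : Fin d) : (basePoint d).1 i.succ = 0 := by
  simp [basePoint]

/-- The point with longitude `t` on the half great circle through `x` from the base point to its
antipode. -/
noncomputable def suspMap (d : ℕ) : C(StdSphere d × I, StdSphere (d + 1)) where
  toFun p := ofSumSq (Fin.cons (Real.cos (Real.pi * p.2)) fun i => Real.sin (Real.pi * p.2) * p.1.1 i)
    (by
      rw [Fin.sum_univ_succ]
      simp only [Fin.cons_zero, Fin.cons_succ, mul_pow, ← Finset.mul_sum, sum_sq]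
      simp)
  continuous_toFun := continuous_ofSumSq _ (continuous_pi fun i => by
    refine Fin.cases ?_ (fun i => ?_) i
    · simp only [Fin.cons_zero]; fun_prop
    · simp only [Fin.cons_succ]; fun_prop)

@[simp] lemma suspMap_apply_zero {d : ℕ} (p : StdSphere d × I) :
    (suspMap d p).1 0 = Real.cos (Real.pi * p.2) := rfl

@[simp] lemma suspMap_apply_succ {d : ℕ} (p : StdSphere d × I) (i : Fin (d + 1)) :
    (suspMap d p).1 i.succ = Real.sin (Real.pi * p.2) * p.1.1 i := rfl

@[simp] lemma suspMap_zero {d : ℕ} (x : StdSphere d) : suspMap d (x, 0) = basePoint (d + 1) := by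
  refine ext' fun i => ?_
  refine Fin.cases ?_ (fun i => ?_) i <;> simp

lemma pi_mul_mem (t : I) : Real.pi * t ∈ Set.Icc 0 Real.pi :=
  ⟨mul_nonneg Real.pi_pos.le t.2.1, mul_le_of_le_one_right Real.pi_pos.le t.2.2⟩

lemma suspMap_surjective (d : ℕ) : Function.Surjective (suspMap d) := by
  intro p
  have hs := sum_sq p
  rw [Fin.sum_univ_succ] at hs
  have hp : p.1 0 ∈ Set.Icc (-1 : ℝ) 1 := by
    have : 0 ≤ ∑ i : Fin (d + 1), p.1 i.succ ^ 2 := Finset.sum_nonneg fun _ _ => sq_nonneg _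
    constructor <;> nlinarith
  let t : I := ⟨Real.arccos (p.1 0) / Real.pi, div_nonneg (Real.arccos_nonneg _) Real.pi_pos.le,
    div_le_one_of_le₀ (Real.arccos_le_pi _) Real.pi_pos.le⟩
  have ht : Real.pi * t = Real.arccos (p.1 0) := mul_div_cancel₀ _ Real.pi_pos.ne'
  have hc : Real.cos (Real.pi * t) = p.1 0 := by rw [ht, Real.cos_arccos hp.1 hp.2]
  have hsum : ∑ i : Fin (d + 1), p.1 i.succ ^ 2 = Real.sin (Real.pi * t) ^ 2 := by
    rw [Real.sin_sq, hc]; linarith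
  -- Where the sine vanishes the point is a pole, and any meridian passes through it.
  by_cases h : Real.sin (Real.pi * t) = 0
  · refine ⟨(basePoint d, t), ext' fun i => ?_⟩
    refine Fin.cases hc (fun i => ?_) i
    rw [h, zero_pow two_ne_zero, Finset.sum_eq_zero_iff_of_nonneg fun _ _ => sq_nonneg _] at hsum
    have := pow_eq_zero_iff two_ne_zero |>.1 (hsum i (Finset.mem_univ _))
    simp [h, this]
  · refine ⟨(ofSumSq (fun i => p.1 i.succ / Real.sin (Real.pi * t)) ?_, t), ext' fun i => ?_⟩
    · simp only [div_pow, ← Finset.sum_div, hsum]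
      exact div_self (pow_ne_zero 2 h)
    · refine Fin.cases hc (fun i => ?_) i
      simp only [suspMap_apply_succ, ofSumSq_apply]
      field_simp

/-- The cosine is injective on `[0, π]` and recovers the height; off the poles, dividing by the sine
recovers the point of the equator. -/
lemma suspMap_eq_suspMap {d : ℕ} {x y : StdSphere d} {s t : I}
    (h : suspMap d (x, s) = suspMap d (y, t)) : s = t ∧ (x = y ∨ t = 0 ∨ t = 1) := by
  have h0 : Real.cos (Real.pi * s) = Real.cos (Real.pi * t) :=
    congrArg (fun p : StdSphere (d + 1) => p.1 0) h
  have h1 := Real.injOn_cos (pi_mul_mem s) (pi_mul_mem t) h0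
  have h2 : s = t := Subtype.ext (mul_left_cancel₀ Real.pi_pos.ne' h1)
  subst h2
  refine ⟨rfl, ?_⟩
  by_cases hs : Real.sin (Real.pi * s) = 0
  · right
    by_contra! hc
    refine (Real.sin_pos_of_pos_of_lt_pi (mul_pos Real.pi_pos ?_) ?_).ne' hs
    · exact lt_of_le_of_ne s.2.1 fun e => hc.1 (Subtype.ext e.symm)
    · exact mul_lt_of_lt_one_right Real.pi_pos
        (lt_of_le_of_ne s.2.2 fun e => hc.2 (Subtype.ext e))
  · left
    refine ext' fun i => mul_left_cancel₀ hs ?_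
    exact congrArg (fun p : StdSphere (d + 1) => p.1 i.succ) h

/-- A map on the cylinder over a sphere which is constant on both ends descends to the
suspension. -/
lemma exists_desc {Z : Type} [TopologicalSpace Z] {d : ℕ} (h : C(StdSphere d × I, Z)) (a b : Z)
    (h0 : ∀ x, h (x, 0) = a) (h1 : ∀ x, h (x, 1) = b) :
    ∃ g : C(StdSphere (d + 1), Z), ∀ p, g (suspMap d p) = h p := by
  -- A continuous surjection from a compact space to a Hausdorff space is closed, hence a quotient
  -- map.
  have hq : Topology.IsQuotientMap (suspMap d) :=
    (map_continuous (suspMap d)).isClosedMap.isQuotientMap (map_continuous _) (suspMap_surjective d)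
  have hh : Function.FactorsThrough h (suspMap d) := by
    rintro ⟨x, s⟩ ⟨y, t⟩ hxy
    obtain ⟨rfl, rfl | rfl | rfl⟩ := suspMap_eq_suspMap hxy
    · rfl
    · rw [h0, h0]
    · rw [h1, h1]
  exact ⟨hq.lift h hh, fun p => congrArg (fun f => f p) (hq.lift_comp h hh)⟩

/-- The rotation of a point `p` by `s` times its angular distance to the base point, in the plane
of the first two coordinates. -/
noncomputable def pull (d : ℕ) : C(StdSphere (d + 1) × I, StdSphere (d + 1)) where
  toFun p := ofSumSq (Fin.cons
      (p.1.1 0 * Real.cos (p.2 * Real.arccos (p.1.1 0)) +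
        p.1.1 1 * Real.sin (p.2 * Real.arccos (p.1.1 0)))
      (Fin.cons (p.1.1 1 * Real.cos (p.2 * Real.arccos (p.1.1 0)) -
        p.1.1 0 * Real.sin (p.2 * Real.arccos (p.1.1 0))) fun i => p.1.1 i.succ.succ))
    (by
      have h := sum_sq p.1
      rw [Fin.sum_univ_succ, Fin.sum_univ_succ] at h
      rw [Fin.sum_univ_succ, Fin.sum_univ_succ]
      simp only [Fin.cons_zero, Fin.cons_succ]
      rw [Fin.succ_zero_eq_one] at h
      linear_combination h + (p.1.1 0 ^ 2 + p.1.1 1 ^ 2) *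
        Real.sin_sq_add_cos_sq (p.2 * Real.arccos (p.1.1 0)))
  continuous_toFun := continuous_ofSumSq _ (continuous_pi fun i => by
    have := Real.continuous_arccos
    refine Fin.cases ?_ (fun i => Fin.cases ?_ (fun i => ?_) i) i
    · simp only [Fin.cons_zero]; fun_prop
    · simp only [Fin.cons_zero, Fin.cons_succ]; fun_prop
    · simp only [Fin.cons_succ]; fun_prop)

@[simp] lemma pull_zero {d : ℕ} (p : StdSphere (d + 1)) : pull d (p, 0) = p := by
  refine ext' fun i => ?_
  refine Fin.cases ?_ (fun i => Fin.cases ?_ (fun i => ?_) i) i <;> simp [pull]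

/-- The meridian of the base point lies in the plane of rotation: rotating back by `s` times the
angle `π t` leaves `(1 - s) π t`. So `pull` deforms the identity to a map that collapses this
meridian, which turns the unreduced suspension into the reduced one. -/
lemma pull_suspMap {d : ℕ} (s t : I) :
    pull d (suspMap d (basePoint d, t), s) = suspMap d (basePoint d, unitInterval.symm s * t) := by
  have h : Real.arccos (Real.cos (Real.pi * t)) = Real.pi * t :=
    Real.arccos_cos (pi_mul_mem t).1 (pi_mul_mem t).2
  have h1 (t : I) : (suspMap d (basePoint d, t)).1 1 = Real.sin (Real.pi * t) := by
    rw [← Fin.succ_zero_eq_one, suspMap_apply_succ]; simp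
  have e : Real.pi * ((1 - (s : ℝ)) * t) = Real.pi * t - s * (Real.pi * t) := by ring
  refine ext' fun i => ?_
  refine Fin.cases ?_ (fun i => Fin.cases ?_ (fun i => ?_) i) i
  · simp [pull, h1, h, e, Real.cos_sub]
  · simp [pull, h1, h, e, Real.sin_sub]
  · simp [pull]

lemma pull_basePoint {d : ℕ} (s : I) : pull d (basePoint (d + 1), s) = basePoint (d + 1) := by
  rw [← suspMap_zero (basePoint d), pull_suspMap, mul_zero]

lemma suspMap_one {d : ℕ} (x y : StdSphere d) : suspMap d (x, 1) = suspMap d (y, 1) := by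
  refine ext' fun i => ?_
  refine Fin.cases ?_ (fun i => ?_) i <;> simp

end StdSphere

/-! ### The mapping cone of a constant map between wedges of spheres -/

namespace SphereWedge

open StdSphere

variable {ι κ : Type}

/-- The base point of a wedge of spheres. -/
noncomputable def pt (d : ι → ℕ) : SphereWedge d := Wedge.base _ _

/-- The inclusion of a sphere in a wedge of spheres. -/
noncomputable def incl (d : ι → ℕ) (i : ι) : C(StdSphere (d i), SphereWedge d) :=
  Wedge.incl (fun i => basePoint (d i)) i

@[simp] lemma incl_basePoint (d : ι → ℕ) (i : ι) : incl d i (basePoint (d i)) = pt d :=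
  Wedge.incl_base (fun i => basePoint (d i)) i

/-- The inclusion of the first summands in a wedge. -/
noncomputable def inlMap (d : ι → ℕ) (e : κ → ℕ) : C(SphereWedge d, SphereWedge (Sum.elim d e)) :=
  Wedge.lift (Z := SphereWedge (Sum.elim d e)) _ (fun i => incl (Sum.elim d e) (Sum.inl i))
    (pt (Sum.elim d e)) (fun i => incl_basePoint (Sum.elim d e) (Sum.inl i))

/-- The mapping cone of the constant map between two wedges of spheres. -/
abbrev ConstCone (d : ι → ℕ) (e : κ → ℕ) : Type :=
  MCone (ContinuousMap.const (SphereWedge e) (pt d))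

/-- The cylinder over the `j`-th sphere in the mapping cone. -/
noncomputable def cylIncl (d : ι → ℕ) (e : κ → ℕ) (j : κ) : C(StdSphere (e j) × I, ConstCone d e) :=
  (MCone.cyl _).comp ((incl e j).prodMap (ContinuousMap.id I))

lemma cylIncl_apply (d : ι → ℕ) (e : κ → ℕ) (j : κ) (x : StdSphere (e j)) (t : I) :
    cylIncl d e j (x, t) = MCone.cyl _ (incl e j x, t) := rfl

lemma exists_suspIncl (d : ι → ℕ) (e : κ → ℕ) (j : κ) :
    ∃ g : C(StdSphere (e j + 1), ConstCone d e), ∀ p, g (suspMap (e j) p) = cylIncl d e j p :=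
  exists_desc (cylIncl d e j) (MCone.inl _ (pt d)) (MCone.apex _)
    (fun _ => MCone.cyl_zero _ _) (fun _ => MCone.cyl_one _ _)

/-- The suspension of the `j`-th sphere in the mapping cone. -/
noncomputable def suspIncl (d : ι → ℕ) (e : κ → ℕ) (j : κ) :
    C(StdSphere (e j + 1), ConstCone d e) := (exists_suspIncl d e j).choose

lemma suspIncl_suspMap (d : ι → ℕ) (e : κ → ℕ) (j : κ) (p : StdSphere (e j) × I) :
    suspIncl d e j (suspMap (e j) p) = cylIncl d e j p := (exists_suspIncl d e j).choose_spec p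

lemma suspIncl_basePoint (d : ι → ℕ) (e : κ → ℕ) (j : κ) :
    suspIncl d e j (basePoint (e j + 1)) = MCone.inl _ (pt d) := by
  rw [← suspMap_zero (basePoint (e j)), suspIncl_suspMap]
  exact MCone.cyl_zero _ _

/-- The map from the wedge to the mapping cone. -/
noncomputable def toCone (d : ι → ℕ) (e : κ → ℕ) :
    C(SphereWedge (Sum.elim d fun j => e j + 1), ConstCone d e) :=
  Wedge.lift (Z := ConstCone d e) _ (fun
    | Sum.inl i => (MCone.inl (ContinuousMap.const (SphereWedge e) (pt d))).comp (incl d i)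
    | Sum.inr j => suspIncl d e j) (MCone.inl _ (pt d)) (by
    rintro (i | j)
    · exact congrArg (MCone.inl _) (incl_basePoint d i)
    · exact suspIncl_basePoint d e j)

/-- The pinched cylinder over a sphere. -/
noncomputable def pinch (d : ι → ℕ) (e : κ → ℕ) (j : κ) :
    C(StdSphere (e j) × I, SphereWedge (Sum.elim d fun j => e j + 1)) :=
  ⟨fun p => incl (Sum.elim d fun j => e j + 1) (Sum.inr j) (pull (e j) (suspMap (e j) p, 1)),
    (map_continuous (incl (Sum.elim d fun j => e j + 1) (Sum.inr j))).comp
      (by fun_prop : Continuous fun p => pull (e j) (suspMap (e j) p, 1))⟩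

lemma pinch_basePoint (d : ι → ℕ) (e : κ → ℕ) (j : κ) (t : I) :
    pinch d e j (basePoint (e j), t) = pt _ := by
  have : pull (e j) (suspMap (e j) (basePoint (e j), t), 1) = basePoint (e j + 1) := by
    rw [pull_suspMap]; simp
  exact (congrArg (incl (Sum.elim d fun j => e j + 1) (Sum.inr j)) this).trans
    (incl_basePoint (Sum.elim d fun j => e j + 1) (Sum.inr j))

lemma pinch_zero (d : ι → ℕ) (e : κ → ℕ) (j : κ) (x : StdSphere (e j)) :
    pinch d e j (x, 0) = pt _ := by
  have : pinch d e j (x, 0) = pinch d e j (basePoint (e j), 0) := by simp [pinch]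
  rw [this, pinch_basePoint]

lemma pinch_one (d : ι → ℕ) (e : κ → ℕ) (j : κ) (x : StdSphere (e j)) :
    pinch d e j (x, 1) = pt _ := by
  have : pinch d e j (x, 1) = pinch d e j (basePoint (e j), 1) := by
    simp [pinch, suspMap_one x (basePoint (e j))]
  rw [this, pinch_basePoint]

/-- The pinched cylinder over a wedge of spheres. -/
noncomputable def pinchWedge (d : ι → ℕ) (e : κ → ℕ) :
    C(SphereWedge e, C(I, SphereWedge (Sum.elim d fun j => e j + 1))) :=
  Wedge.lift _ (fun j => (pinch d e j).curry) (.const _ (pt _)) (fun j => by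
    ext t; exact pinch_basePoint d e j t)

/-- The map from the mapping cone to the wedge. -/
noncomputable def ofCone (d : ι → ℕ) (e : κ → ℕ) :
    C(ConstCone d e, SphereWedge (Sum.elim d fun j => e j + 1)) :=
  MCone.lift _ (inlMap d _) (pinchWedge d e).uncurry (pt _)
    (Wedge.ind rfl fun j y => pinch_zero d e j y) (Wedge.ind rfl fun j y => pinch_one d e j y)

lemma ofCone_suspIncl (d : ι → ℕ) (e : κ → ℕ) (j : κ) (y : StdSphere (e j + 1)) :
    ofCone d e (suspIncl d e j y) =
      incl (Sum.elim d fun j => e j + 1) (Sum.inr j) (pull (e j) (y, 1)) := by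
  obtain ⟨p, rfl⟩ := suspMap_surjective (e j) y
  rw [suspIncl_suspMap]
  rfl

/-- On an old sphere the composite is the inclusion, on a suspended one it is `pull` at time 1, so
`pull` itself is the homotopy. -/
lemma ofCone_comp_toCone (d : ι → ℕ) (e : κ → ℕ) :
    ((ofCone d e).comp (toCone d e)).Homotopic (ContinuousMap.id _) := by
  refine ContinuousMap.Homotopic.symm ?_
  refine Wedge.homotopic_of (fun
    | Sum.inl i => (incl (Sum.elim d fun j => e j + 1) (Sum.inl i)).comp ContinuousMap.fst
    | Sum.inr j => (incl (Sum.elim d fun j => e j + 1) (Sum.inr j)).comp (pull (e j)))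
    (.const _ (pt _)) ?_ rfl rfl ?_ ?_
  · rintro (i | j) s
    · exact incl_basePoint (Sum.elim d fun j => e j + 1) (Sum.inl i)
    · exact (congrArg (incl (Sum.elim d fun j => e j + 1) (Sum.inr j)) (pull_basePoint s)).trans
        (incl_basePoint (Sum.elim d fun j => e j + 1) (Sum.inr j))
  · rintro (i | j) y
    · rfl
    · exact (congrArg (incl (Sum.elim d fun j => e j + 1) (Sum.inr j)) (pull_zero y)).symm
  · rintro (i | j) y
    · rfl
    · exact ofCone_suspIncl d e j y

/-- The homotopy that retracts the cone over the base point. -/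
noncomputable def retractHomotopy (d : ι → ℕ) (e : κ → ℕ) :
    C(SphereWedge e, C(I × I, ConstCone d e)) :=
  Wedge.lift _ (fun j => ContinuousMap.curry
      ⟨fun p : StdSphere (e j) × (I × I) =>
        suspIncl d e j (pull (e j) (suspMap (e j) (p.1, p.2.1), p.2.2)), by fun_prop⟩)
    ⟨fun p => MCone.cyl _ (pt e, unitInterval.symm p.2 * p.1), by fun_prop⟩ (fun j => by
      ext p
      have : suspIncl d e j (pull (e j) (suspMap (e j) (basePoint (e j), p.1), p.2)) =
          MCone.cyl _ (pt e, unitInterval.symm p.2 * p.1) := by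
        rw [pull_suspMap, suspIncl_suspMap, cylIncl_apply, incl_basePoint]
      exact this)

lemma retractHomotopy_incl (d : ι → ℕ) (e : κ → ℕ) (j : κ) (x : StdSphere (e j)) (t s : I) :
    retractHomotopy d e (incl e j x) (t, s) =
      suspIncl d e j (pull (e j) (suspMap (e j) (x, t), s)) := rfl

lemma retractHomotopy_pt (d : ι → ℕ) (e : κ → ℕ) (t s : I) :
    retractHomotopy d e (pt e) (t, s) = MCone.cyl _ (pt e, unitInterval.symm s * t) := rfl

/-- On each suspended sphere `pull` is again the homotopy. The apex cannot stay fixed: it slides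
down the segment over the base point, at the speed at which `pull` shortens that meridian. -/
lemma toCone_comp_ofCone (d : ι → ℕ) (e : κ → ℕ) :
    ((toCone d e).comp (ofCone d e)).Homotopic (ContinuousMap.id _) := by
  refine ContinuousMap.Homotopic.symm ?_
  refine MCone.homotopic_of _ ⟨fun x => MCone.inl _ x.1, by fun_prop⟩
    ⟨fun x => retractHomotopy d e x.1.1 (x.1.2, x.2), continuous_eval.comp
      (by fun_prop : Continuous fun x : (SphereWedge e × I) × I =>
        (retractHomotopy d e x.1.1, (x.1.2, x.2)))⟩
    ⟨fun s => MCone.cyl _ (pt e, unitInterval.symm s), by fun_prop⟩ ?_ ?_ (fun _ => rfl) ?_ ?_ ?_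
    ?_ ?_
  · intro l s
    refine Wedge.ind (p := fun l => retractHomotopy d e l (0, s) = MCone.inl _ (pt d)) ?_ ?_ l
    · refine (retractHomotopy_pt d e 0 s).trans ?_
      rw [mul_zero]; exact MCone.cyl_zero _ _
    · intro j x
      refine (retractHomotopy_incl d e j x 0 s).trans ?_
      rw [suspMap_zero, pull_basePoint, suspIncl_basePoint]
  · intro l s
    refine Wedge.ind (p := fun l => retractHomotopy d e l (1, s) =
      MCone.cyl _ (pt e, unitInterval.symm s)) ?_ ?_ l
    · refine (retractHomotopy_pt d e 1 s).trans ?_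
      rw [mul_one]
    · intro j x
      refine (retractHomotopy_incl d e j x 1 s).trans ?_
      rw [suspMap_one x (basePoint _), pull_suspMap, suspIncl_suspMap, cylIncl_apply,
        incl_basePoint, mul_one]
  · intro x
    refine Wedge.ind (p := fun x => toCone d e (ofCone d e (MCone.inl _ x)) = MCone.inl _ x)
      ?_ ?_ x
    · rfl
    · intro i y; rfl
  · rintro ⟨l, t⟩
    refine Wedge.ind (p := fun l => MCone.cyl _ (l, t) = retractHomotopy d e l (t, 0)) ?_ ?_ l
    · refine ((retractHomotopy_pt d e t 0).trans ?_).symm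
      rw [unitInterval.symm_zero, one_mul]; rfl
    · intro j x
      refine ((retractHomotopy_incl d e j x t 0).trans ?_).symm
      rw [pull_zero, suspIncl_suspMap]; rfl
  · rintro ⟨l, t⟩
    refine Wedge.ind (p := fun l => toCone d e (ofCone d e (MCone.cyl _ (l, t))) =
      retractHomotopy d e l (t, 1)) ?_ ?_ l
    · refine ((retractHomotopy_pt d e t 1).trans ?_).symm
      rw [unitInterval.symm_one, zero_mul]; exact MCone.cyl_zero _ _
    · intro j x; rfl
  · exact ((congrArg (fun s => MCone.cyl _ (pt e, s)) unitInterval.symm_zero).trans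
      (MCone.cyl_one _ _)).symm
  · exact ((congrArg (fun s => MCone.cyl _ (pt e, s)) unitInterval.symm_one).trans
      (MCone.cyl_zero _ _)).symm

/-- The mapping cone of a constant map between wedges of spheres is a wedge of spheres. -/
noncomputable def constConeEquiv (d : ι → ℕ) (e : κ → ℕ) :
    ConstCone d e ≃ₕ SphereWedge (Sum.elim d fun j => e j + 1) where
  toFun := ofCone d e
  invFun := toCone d e
  left_inv := toCone_comp_ofCone d e
  right_inv := ofCone_comp_toCone d e

end SphereWedge

/-! ### Cones over the empty space, connectedness and reindexing -/

namespace SphereWedge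

open StdSphere

variable {ι κ : Type}

/-- The map from `S^0` to the cone of a map from the empty space. -/
noncomputable def ofZeroSphere {L : Type} [TopologicalSpace L] (d : ι → ℕ) :
    C(StdSphere 0, MCone (ContinuousMap.const L (pt d))) where
  toFun p := if 0 ≤ p.1 0 then MCone.inl _ (pt d) else MCone.apex _
  continuous_toFun := by
    refine Continuous.if_le continuous_const continuous_const continuous_const
      (continuous_apply 0) fun p hp => ?_
    -- The coordinate of a point of `S^0` is never 0, so the two cases never have to be matched.
    have := sum_sq p
    simp [← hp] at this

/-- The antipode of the base point of `S^0`. -/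
noncomputable def zeroSphereAntipode : StdSphere 0 := ofSumSq (fun _ => -1) (by simp)

lemma zeroSphere_eq (p : StdSphere 0) :
    p = if 0 ≤ p.1 0 then basePoint 0 else zeroSphereAntipode := by
  have h : p.1 0 ^ 2 = 1 := by simpa using sum_sq p
  refine ext' fun i => ?_
  have : Subsingleton (Fin (0 + 1)) := inferInstanceAs (Subsingleton (Fin 1))
  obtain rfl : i = 0 := Subsingleton.elim _ _
  split_ifs with h0
  · rw [basePoint_zero]; nlinarith
  · change p.1 0 = -1; nlinarith

/-- The map from the cone of a map from the empty space to a wedge with `S^0`. -/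
noncomputable def ofEmptyCone (L : Type) [TopologicalSpace L] [IsEmpty L] (d : ι → ℕ) :
    C(MCone (ContinuousMap.const L (pt d)), SphereWedge (Sum.elim d fun _ : Unit => 0)) :=
  MCone.lift _ (inlMap d _) ⟨fun p => isEmptyElim p.1,
      continuous_iff_continuousAt.2 fun p => isEmptyElim p.1⟩
    (incl (Sum.elim d fun _ : Unit => 0) (Sum.inr ()) zeroSphereAntipode)
    (fun l => isEmptyElim l) (fun l => isEmptyElim l)

lemma ofEmptyCone_ofZeroSphere {L : Type} [TopologicalSpace L] [IsEmpty L] (d : ι → ℕ)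
    (y : StdSphere 0) : ofEmptyCone L d (ofZeroSphere d y) =
      incl (Sum.elim d fun _ : Unit => 0) (Sum.inr ()) y := by
  have h : ofZeroSphere (L := L) d y =
    if 0 ≤ y.1 0 then MCone.inl _ (pt d) else MCone.apex _ := rfl
  rw [h]
  conv_rhs => rw [zeroSphere_eq y]
  split_ifs with h
  · exact (incl_basePoint (Sum.elim d fun _ : Unit => 0) (Sum.inr ())).symm
  · rfl

/-- The mapping cone of a map from the empty space to a wedge of spheres. -/
noncomputable def emptyConeEquiv {L : Type} [TopologicalSpace L] [IsEmpty L] (d : ι → ℕ) :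
    MCone (ContinuousMap.const L (pt d)) ≃ₕ SphereWedge (Sum.elim d fun _ : Unit => 0) where
  toFun := ofEmptyCone L d
  invFun := Wedge.lift (Z := MCone (ContinuousMap.const L (pt d))) _ (fun
    | Sum.inl i => (MCone.inl (ContinuousMap.const L (pt d))).comp (incl d i)
    | Sum.inr _ => ofZeroSphere d) (MCone.inl _ (pt d)) (by
    rintro (i | j)
    · exact congrArg (MCone.inl _) (incl_basePoint d i)
    · exact if_pos (by simp))
  left_inv := by
    convert ContinuousMap.Homotopic.refl _
    refine (MCone.hom_ext ?_ (fun l => isEmptyElim l) ?_).symm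
    · exact Wedge.ind rfl fun _ _ => rfl
    · exact if_neg (by simp [zeroSphereAntipode])
  right_inv := by
    convert ContinuousMap.Homotopic.refl _
    symm
    refine Wedge.hom_ext ?_ ?_
    · rfl
    rintro (i | ⟨⟩) y
    · rfl
    · exact ofEmptyCone_ofZeroSphere (L := L) d y

lemma pathConnectedSpace (d : ι → ℕ) (hd : ∀ i, 1 ≤ d i) : PathConnectedSpace (SphereWedge d) := by
  have key : ∀ w : SphereWedge d, Joined (pt d) w := by
    refine Wedge.ind (Joined.refl _) fun i y => ?_
    have hr : 1 < Module.rank ℝ (EuclideanSpace ℝ (Fin (d i + 1))) := by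
      rw [rank_eq_card_basis (EuclideanSpace.basisFun (Fin (d i + 1)) ℝ).toBasis]
      simpa using hd i
    have : PathConnectedSpace (StdSphere (d i)) :=
      isPathConnected_iff_pathConnectedSpace.1 (isPathConnected_sphere hr 0 zero_le_one)
    have h := (PathConnectedSpace.joined (basePoint (d i)) y).map (map_continuous (incl d i))
    rwa [incl_basePoint] at h
  exact ⟨⟨pt d⟩, fun x y => (key x).symm.trans (key y)⟩

/-- The inclusion of a sphere whose dimension is only propositionally that of the summand. -/
noncomputable def inclOfEq (d : ι → ℕ) (i : ι) {n : ℕ} (h : d i = n) : C(StdSphere n, SphereWedge d) :=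
  h ▸ incl d i

lemma inclOfEq_basePoint (d : ι → ℕ) (i : ι) {n : ℕ} (h : d i = n) :
    inclOfEq d i h (basePoint n) = pt d := by
  subst h; exact incl_basePoint d i

/-- Reindexing of a wedge of spheres. -/
noncomputable def reindexMap (d : ι → ℕ) (d' : κ → ℕ) (f : ι → κ) (h : ∀ i, d' (f i) = d i) :
    C(SphereWedge d, SphereWedge d') :=
  Wedge.lift _ (fun i => inclOfEq d' (f i) (h i)) (pt d') fun _ => inclOfEq_basePoint d' _ _

lemma reindexMap_inclOfEq (d : ι → ℕ) (d' : κ → ℕ) (f : ι → κ) (h : ∀ i, d' (f i) = d i)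
    (i : ι) {n : ℕ} (hn : d i = n) (y : StdSphere n) :
    reindexMap d d' f h (inclOfEq d i hn y) = inclOfEq d' (f i) ((h i).trans hn) y := by
  subst hn; rfl

lemma reindexMap_comp (d : ι → ℕ) (d' : κ → ℕ) (f : ι → κ) (h : ∀ i, d' (f i) = d i)
    (g : κ → ι) (h' : ∀ j, d (g j) = d' j) (hgf : ∀ i, g (f i) = i) :
    (reindexMap d' d g h').comp (reindexMap d d' f h) = ContinuousMap.id _ := by
  refine Wedge.hom_ext rfl fun i y => ?_
  refine (reindexMap_inclOfEq d' d g h' (f i) (h i) y).trans ?_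
  have : ∀ j (hj : d j = d i), j = i → inclOfEq d j hj y = incl d i y := by
    rintro j hj rfl; rfl
  exact this _ _ (hgf i)

/-- Reindexing of a wedge of spheres along an equivalence. -/
noncomputable def reindexEquiv (d : ι → ℕ) (e : κ ≃ ι) :
    SphereWedge d ≃ₕ SphereWedge (d ∘ e) where
  toFun := reindexMap d (d ∘ e) e.symm (by simp)
  invFun := reindexMap (d ∘ e) d e (by simp)
  left_inv := by rw [reindexMap_comp _ _ _ _ _ _ (by simp)]
  right_inv := by rw [reindexMap_comp _ _ _ _ _ _ (by simp)]

end SphereWedge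

/-! ### Homotopy wedges of spheres with a lower bound on the dimensions -/

/-- `Y` is homotopy equivalent to a finite wedge of spheres of dimensions `≥ c - 1`. -/
def IsHomotopySphereWedge (c : ℕ) (Y : Type) [TopologicalSpace Y] : Prop :=
  ∃ (ι : Type) (_ : Finite ι) (d : ι → ℕ), (∀ i, c ≤ d i + 1) ∧ Nonempty (Y ≃ₕ SphereWedge d)

namespace IsHomotopySphereWedge

variable {X Y : Type} [TopologicalSpace X] [TopologicalSpace Y] {c : ℕ}

lemma isHomotopyWedgeOfSpheres (h : IsHomotopySphereWedge c X) : IsHomotopyWedgeOfSpheres X := by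
  obtain ⟨ι, _, d, -, ⟨e⟩⟩ := h
  obtain ⟨n, ⟨f⟩⟩ := Finite.exists_equiv_fin ι
  exact ⟨n, d ∘ f.symm, ⟨e.trans (SphereWedge.reindexEquiv d f.symm)⟩⟩

lemma of_homotopyEquiv (h : IsHomotopySphereWedge c Y) (e : X ≃ₕ Y) : IsHomotopySphereWedge c X := by
  obtain ⟨ι, hι, d, hd, ⟨e'⟩⟩ := h
  exact ⟨ι, hι, d, hd, ⟨e.trans e'⟩⟩

lemma mono {c' : ℕ} (h : IsHomotopySphereWedge c X) (hc : c' ≤ c) : IsHomotopySphereWedge c' X := by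
  obtain ⟨ι, hι, d, hd, e⟩ := h
  exact ⟨ι, hι, d, fun i => hc.trans (hd i), e⟩

lemma of_contractible [ContractibleSpace X] : IsHomotopySphereWedge c X := by
  refine ⟨Empty, inferInstance, Empty.elim, fun i => i.elim, ?_⟩
  obtain ⟨e⟩ := ContractibleSpace.hequiv_unit X
  refine ⟨e.trans ⟨.const _ (SphereWedge.pt _), .const _ (), ?_, ?_⟩⟩
  · exact ContinuousMap.Homotopic.refl _
  · convert ContinuousMap.Homotopic.refl _
    exact Wedge.hom_ext rfl fun i => i.elim

lemma pathConnectedSpace (h : IsHomotopySphereWedge c X) (hc : 2 ≤ c) : PathConnectedSpace X := by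
  obtain ⟨ι, hι, d, hd, ⟨e⟩⟩ := h
  have := SphereWedge.pathConnectedSpace d fun i => by have := hd i; omega
  obtain ⟨G⟩ := e.left_inv
  have key : ∀ x, Joined (e.invFun (e.toFun x)) x := fun x => by
    refine ⟨⟨⟨fun t => G (t, x), by fun_prop⟩, ?_, ?_⟩⟩ <;> simp
  refine ⟨⟨e.invFun (SphereWedge.pt d)⟩, fun x y => ?_⟩
  exact (key x).symm.trans (((PathConnectedSpace.joined (e.toFun x) (e.toFun y)).map
    (map_continuous e.invFun)).trans (key y))

lemma exists_joined_pt {ι : Type} {d : ι → ℕ} [PathConnectedSpace X] (e : X ≃ₕ SphereWedge d)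
    (w : SphereWedge d) : Joined w (SphereWedge.pt d) := by
  obtain ⟨G⟩ := e.right_inv
  have key : ∀ x, Joined (e.toFun (e.invFun x)) x := fun x => by
    refine ⟨⟨⟨fun t => G (t, x), by fun_prop⟩, ?_, ?_⟩⟩ <;> simp
  exact (key w).symm.trans (((PathConnectedSpace.joined (e.invFun w) (e.invFun _)).map
    (map_continuous e.toFun)).trans (key _))

/-- The mapping cone of a null-homotopic map between homotopy wedges of spheres is one, too. -/
lemma mCone {L : Type} [TopologicalSpace L] [CompactSpace L] [T2Space L] [PathConnectedSpace X]
    (hX : IsHomotopySphereWedge (c + 1) X)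
    (hL : (c = 0 ∧ IsEmpty L) ∨ IsHomotopySphereWedge c L) (f : C(L, X))
    (hf : ∃ x, f.Homotopic (.const L x)) : IsHomotopySphereWedge (c + 1) (MCone f) := by
  obtain ⟨ι, hι, d, hd, ⟨e⟩⟩ := hX
  obtain ⟨x, hx⟩ := hf
  -- The null-homotopy may end at any point; path-connectedness moves that point to the base point
  -- of the wedge.
  obtain ⟨γ⟩ := exists_joined_pt e (e.toFun x)
  obtain ⟨E₁⟩ := MCone.nonempty_homotopyEquiv_target f e
  have h1 : (e.toFun.comp f).Homotopic (.const L (e.toFun x)) :=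
    (ContinuousMap.Homotopic.refl e.toFun).comp hx
  have h2 : (ContinuousMap.const L (e.toFun x)).Homotopic (.const L (SphereWedge.pt d)) :=
    ⟨⟨⟨fun p => γ p.1, by fun_prop⟩, by simp, by simp⟩⟩
  obtain ⟨G⟩ := h1.trans h2
  let E₂ := E₁.trans (MCone.shiftEquiv (MCone.tracePath G (ContinuousMap.id L)))
  rcases hL with ⟨rfl, hL⟩ | ⟨κ, hκ, d', hd', ⟨e'⟩⟩
  -- Over an empty source the apex is an isolated point and contributes a summand `S^0`.
  · exact ⟨ι ⊕ Unit, inferInstance, _, by rintro (i | i); exacts [hd i, le_rfl],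
      ⟨E₂.trans (SphereWedge.emptyConeEquiv d)⟩⟩
  · refine ⟨ι ⊕ κ, inferInstance, _, ?_, ⟨(E₂.trans (MCone.sourceEquiv _ e')).trans
      (SphereWedge.constConeEquiv d d')⟩⟩
    rintro (i | i)
    exacts [hd i, Nat.succ_le_succ (hd' i)]

end IsHomotopySphereWedge

/-! ### Realizations of independence complexes on vertex subsets -/

namespace SimpleGraph

variable {V : Type}

open Classical in
/-- A point on the segment from `x` to the vertex `u`. -/
noncomputable def segment (u : V) (x : V → ℝ) (t : ℝ) : V → ℝ :=
  (1 - t) • x + t • Pi.single u 1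

lemma segment_zero (u : V) (x : V → ℝ) : segment u x 0 = x := by simp [segment]

lemma segment_apply_of_ne {u v : V} (h : v ≠ u) (x : V → ℝ) (t : ℝ) :
    segment u x t v = (1 - t) * x v := by simp [segment, h]

lemma segment_apply_self (u : V) (x : V → ℝ) (t : ℝ) :
    segment u x t u = (1 - t) * x u + t := by simp [segment]

@[fun_prop]
lemma continuous_segment {X : Type} [TopologicalSpace X] (u : V) {f : X → V → ℝ} {g : X → ℝ}
    (hf : Continuous f) (hg : Continuous g) : Continuous fun p => segment u (f p) (g p) := by
  unfold segment; fun_prop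

open Classical in
/-- The point obtained from `x` by moving the proportion `t` of the mass at `v` to `u`. -/
noncomputable def shiftMass (u v : V) (x : V → ℝ) (t : ℝ) : V → ℝ :=
  x + (t * x v) • (Pi.single u 1 - Pi.single v 1)

@[fun_prop]
lemma continuous_shiftMass {X : Type} [TopologicalSpace X] (u v : V) {f : X → V → ℝ} {g : X → ℝ}
    (hf : Continuous f) (hg : Continuous g) : Continuous fun p => shiftMass u v (f p) (g p) := by
  unfold shiftMass; fun_prop

lemma shiftMass_left {u v : V} (h : u ≠ v) (x : V → ℝ) (t : ℝ) :
    shiftMass u v x t u = x u + t * x v := by simp [shiftMass, h]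

lemma shiftMass_right {u v : V} (h : u ≠ v) (x : V → ℝ) (t : ℝ) :
    shiftMass u v x t v = (1 - t) * x v := by simp [shiftMass, h.symm]; ring

lemma shiftMass_of_ne {u v w : V} (hu : w ≠ u) (hv : w ≠ v) (x : V → ℝ) (t : ℝ) :
    shiftMass u v x t w = x w := by simp [shiftMass, hu, hv]

/-- The vertices of the link of `v` in the independence complex on `S`. -/
def indepLink (G : SimpleGraph V) (S : Set V) (v : V) : Set V := {w | w ∈ S ∧ w ≠ v ∧ ¬ G.Adj v w}

lemma indepLink_subset (G : SimpleGraph V) (S : Set V) (v : V) : G.indepLink S v ⊆ S \ {v} :=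
  fun _ hw => ⟨hw.1, hw.2.1⟩

variable [Fintype V] (G : SimpleGraph V)

/-- The geometric realization of the independence complex of the subgraph induced on `S`. -/
def indepReal (S : Set V) : Set (V → ℝ) :=
  {x | (∀ v, 0 ≤ x v) ∧ ∑ v, x v = 1 ∧ (∀ v, v ∉ S → x v = 0) ∧ ∀ u v, G.Adj u v → x u * x v = 0}

variable {G} {S T : Set V}

lemma isClosed_indepReal : IsClosed (G.indepReal S) := by
  simp only [indepReal, Set.ofPred_and, Set.ofPred_forall]
  refine (isClosed_iInter fun v => isClosed_le (by fun_prop) (by fun_prop)).inter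
    ((isClosed_eq (by fun_prop) (by fun_prop)).inter ((isClosed_iInter fun v =>
      isClosed_iInter fun _ => isClosed_eq (by fun_prop) (by fun_prop)).inter
      (isClosed_iInter fun u => isClosed_iInter fun v => isClosed_iInter fun _ =>
        isClosed_eq (by fun_prop) (by fun_prop))))

instance : CompactSpace (G.indepReal S) := by
  refine isCompact_iff_compactSpace.1 ((isCompact_univ_pi fun _ => isCompact_Icc (a := (0 : ℝ))
    (b := 1)).of_isClosed_subset isClosed_indepReal fun x hx v _ => ⟨hx.1 v, ?_⟩)
  rw [← hx.2.1]
  exact Finset.single_le_sum (fun w _ => hx.1 w) (Finset.mem_univ v)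

lemma indepReal_mono (h : S ⊆ T) : G.indepReal S ⊆ G.indepReal T :=
  fun _ hx => ⟨hx.1, hx.2.1, fun v hv => hx.2.2.1 v fun hv' => hv (h hv'), hx.2.2.2⟩

/-- The inclusion of realizations. -/
def indepIncl (G : SimpleGraph V) (h : S ⊆ T) : C(G.indepReal S, G.indepReal T) :=
  ⟨Set.inclusion (indepReal_mono h), continuous_inclusion _⟩

lemma isEmpty_indepReal : IsEmpty (G.indepReal ∅) := by
  refine ⟨fun x => ?_⟩
  have h := x.2.2.1
  rw [Finset.sum_eq_zero fun v _ => x.2.2.2.1 v (Set.notMem_empty v)] at h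
  exact zero_ne_one h

open Classical in
lemma single_mem_indepReal {u : V} (hu : u ∈ S) : Pi.single u 1 ∈ G.indepReal S := by
  refine ⟨fun v => ?_, by simp, fun v hv => ?_, fun a b hab => ?_⟩
  · by_cases h : v = u
    · subst h; simp
    · simp [h]
  · rw [Pi.single_eq_of_ne]; rintro rfl; exact hv hu
  · by_cases h : a = u
    · subst h; simp [Pi.single_eq_of_ne hab.ne']
    · simp [Pi.single_eq_of_ne h]

lemma segment_mem_indepReal {u : V} (hST : S ⊆ T) (hu : u ∈ T) (h : ∀ w ∈ S, ¬ G.Adj u w)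
    {x : V → ℝ} (hx : x ∈ G.indepReal S) {t : ℝ} (ht : t ∈ I) : segment u x t ∈ G.indepReal T := by
  have h1 : 0 ≤ 1 - t := by linarith [ht.2]
  refine ⟨fun v => ?_, ?_, fun v hv => ?_, fun a b hab => ?_⟩
  · by_cases hv : v = u
    · subst hv; rw [segment_apply_self]; exact add_nonneg (mul_nonneg h1 (hx.1 v)) ht.1
    · rw [segment_apply_of_ne hv]; exact mul_nonneg h1 (hx.1 v)
  · classical
    simp [segment, Finset.sum_add_distrib, ← Finset.mul_sum, hx.2.1]
  · rw [segment_apply_of_ne (by rintro rfl; exact hv hu), hx.2.2.1 v fun h => hv (hST h), mul_zero]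
  · have key : ∀ b, G.Adj u b → segment u x t b = 0 := fun b hb => by
      rw [segment_apply_of_ne hb.ne', hx.2.2.1 b fun hb' => h b hb' hb, mul_zero]
    by_cases ha : a = u
    · subst ha; rw [key b hab, mul_zero]
    by_cases hb : b = u
    · subst hb; rw [key a hab.symm, zero_mul]
    · rw [segment_apply_of_ne ha, segment_apply_of_ne hb]
      linear_combination (1 - t) * (1 - t) * hx.2.2.2 a b hab

/-- The inclusion of the realization of the complex on `S` in that of the complex on `T` is
null-homotopic. -/
def IndepNullhomotopic (G : SimpleGraph V) (S T : Set V) : Prop :=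
  ∃ (h : S ⊆ T) (p : G.indepReal T), (indepIncl G h).Homotopic (.const _ p)

/-- Since `u` can be added to every simplex on `S`, the straight segments to `u` stay in the complex
on `T`. -/
lemma IndepNullhomotopic.of_apex {u : V} (hST : S ⊆ T) (hu : u ∈ T) (h : ∀ w ∈ S, ¬ G.Adj u w) :
    IndepNullhomotopic G S T := by
  classical
  refine ⟨hST, ⟨_, single_mem_indepReal hu⟩, ⟨⟨⟨fun p => ⟨segment u p.2 p.1,
    segment_mem_indepReal hST hu h p.2.2 p.1.2⟩, ?_⟩, ?_, ?_⟩⟩⟩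
  · exact Continuous.subtype_mk (by fun_prop) _
  · intro x; exact Subtype.ext (segment_zero u _)
  · intro x; refine Subtype.ext ?_; simp [segment]

lemma IndepNullhomotopic.mono {S' T' : Set V} (h : IndepNullhomotopic G S T) (hS : S' ⊆ S)
    (hT : T ⊆ T') : IndepNullhomotopic G S' T' := by
  obtain ⟨hST, p, hp⟩ := h
  exact ⟨hS.trans (hST.trans hT), indepIncl G hT p,
    ((ContinuousMap.Homotopic.refl (indepIncl G hT)).comp hp).comp (.refl (indepIncl G hS))⟩

lemma contractibleSpace_indepReal {u : V} (hu : u ∈ S) (h : ∀ w ∈ S, ¬ G.Adj u w) :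
    ContractibleSpace (G.indepReal S) := by
  obtain ⟨h, p, hp⟩ := IndepNullhomotopic.of_apex (Set.Subset.refl S) hu h
  exact (contractible_iff_id_nullhomotopic _).2 ⟨p, hp⟩

/-! #### Removal of dominated vertices -/

/-- The new mass at `u` comes from `v`, and every neighbour of `u` in `S` is a neighbour of `v`;
such a neighbour has no mass if `u` or `v` had some. -/
lemma shiftMass_mem_indepReal {u v : V} (hu : u ∈ S) (hv : v ∈ S) (huv : u ≠ v)
    (h : ∀ w ∈ S, G.Adj u w → G.Adj v w) {x : V → ℝ} (hx : x ∈ G.indepReal S) {t : ℝ}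
    (ht : t ∈ I) : shiftMass u v x t ∈ G.indepReal S := by
  have hadj : ¬ G.Adj u v := fun e => G.loopless.irrefl v (h v hv e)
  refine ⟨fun w => ?_, ?_, fun w hw => ?_, ?_⟩
  · by_cases h1 : w = u
    · subst h1; rw [shiftMass_left huv]
      exact add_nonneg (hx.1 w) (mul_nonneg ht.1 (hx.1 v))
    by_cases h2 : w = v
    · subst h2; rw [shiftMass_right huv]
      exact mul_nonneg (by linarith [ht.2]) (hx.1 w)
    · rw [shiftMass_of_ne h1 h2]; exact hx.1 w
  · classical
    simp [shiftMass, Finset.sum_add_distrib, ← Finset.mul_sum, hx.2.1]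
  · rw [shiftMass_of_ne (by rintro rfl; exact hw hu) (by rintro rfl; exact hw hv)]
    exact hx.2.2.1 w hw
  · have key1 : ∀ b, G.Adj u b → shiftMass u v x t u * shiftMass u v x t b = 0 := fun b hb => by
      have hbv : b ≠ v := by rintro rfl; exact hadj hb
      rw [shiftMass_left huv, shiftMass_of_ne hb.ne' hbv]
      by_cases hbS : b ∈ S
      · linear_combination hx.2.2.2 u b hb + t * hx.2.2.2 v b (h b hbS hb)
      · rw [hx.2.2.1 b hbS, mul_zero]
    have key2 : ∀ b, G.Adj v b → shiftMass u v x t v * shiftMass u v x t b = 0 := fun b hb => by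
      have hbu : b ≠ u := by rintro rfl; exact hadj hb.symm
      rw [shiftMass_right huv, shiftMass_of_ne hbu hb.ne']
      linear_combination (1 - t) * hx.2.2.2 v b hb
    intro a b hab
    by_cases h1 : a = u
    · subst h1; exact key1 b hab
    by_cases h2 : a = v
    · subst h2; exact key2 b hab
    by_cases h3 : b = u
    · subst h3; rw [mul_comm]; exact key1 a hab.symm
    by_cases h4 : b = v
    · subst h4; rw [mul_comm]; exact key2 a hab.symm
    rw [shiftMass_of_ne h1 h2, shiftMass_of_ne h3 h4]
    exact hx.2.2.2 a b hab

lemma shiftMass_one_mem_indepReal {u v : V} (hu : u ∈ S) (hv : v ∈ S) (huv : u ≠ v)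
    (h : ∀ w ∈ S, G.Adj u w → G.Adj v w) {x : V → ℝ} (hx : x ∈ G.indepReal S) :
    shiftMass u v x 1 ∈ G.indepReal (S \ {v}) := by
  have h1 := shiftMass_mem_indepReal hu hv huv h hx unitInterval.one_mem
  refine ⟨h1.1, h1.2.1, fun w hw => ?_, h1.2.2.2⟩
  by_cases hwv : w = v
  · subst hwv; rw [shiftMass_right huv]; ring
  · exact h1.2.2.1 w fun hw' => hw ⟨hw', hwv⟩

/-- The retraction that removes a dominated vertex. -/
noncomputable def foldMap {u v : V} (hu : u ∈ S) (hv : v ∈ S) (huv : u ≠ v)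
    (h : ∀ w ∈ S, G.Adj u w → G.Adj v w) : C(G.indepReal S, G.indepReal (S \ {v})) :=
  ⟨fun x => ⟨shiftMass u v x 1, shiftMass_one_mem_indepReal hu hv huv h x.2⟩,
    Continuous.subtype_mk (by fun_prop) _⟩

lemma foldMap_homotopic {u v : V} (hu : u ∈ S) (hv : v ∈ S) (huv : u ≠ v)
    (h : ∀ w ∈ S, G.Adj u w → G.Adj v w) :
    ((indepIncl G Set.sdiff_subset).comp (foldMap hu hv huv h)).Homotopic (ContinuousMap.id _) := by
  refine ContinuousMap.Homotopic.symm ⟨⟨⟨fun p => ⟨shiftMass u v p.2 p.1,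
    shiftMass_mem_indepReal hu hv huv h p.2.2 p.1.2⟩, ?_⟩, ?_, ?_⟩⟩
  · exact Continuous.subtype_mk (by fun_prop) _
  · intro x; refine Subtype.ext ?_; simp [shiftMass]
  · intro x; rfl

/-- Removing a dominated vertex does not change the homotopy type. -/
noncomputable def foldEquiv {u v : V} (hu : u ∈ S) (hv : v ∈ S) (huv : u ≠ v)
    (h : ∀ w ∈ S, G.Adj u w → G.Adj v w) : G.indepReal S ≃ₕ G.indepReal (S \ {v}) where
  toFun := foldMap hu hv huv h
  invFun := indepIncl G Set.sdiff_subset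
  left_inv := foldMap_homotopic hu hv huv h
  right_inv := by
    convert ContinuousMap.Homotopic.refl _
    symm
    refine ContinuousMap.ext fun x => Subtype.ext ?_
    have : x.1 v = 0 := x.2.2.2.1 v fun hv' => hv'.2 rfl
    simp [foldMap, indepIncl, shiftMass, this]

lemma IndepNullhomotopic.of_dominated {u v : V} (hu : u ∈ S) (hv : v ∈ S) (huv : u ≠ v)
    (h : ∀ w ∈ S, G.Adj u w → G.Adj v w) (hST : S ⊆ T) (hn : IndepNullhomotopic G (S \ {v}) T) :
    IndepNullhomotopic G S T := by
  obtain ⟨h', p, hp⟩ := hn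
  have h1 : ((indepIncl G hST).comp ((indepIncl G Set.sdiff_subset).comp
      (foldMap hu hv huv h))).Homotopic (indepIncl G hST) :=
    (ContinuousMap.Homotopic.refl (indepIncl G hST)).comp (foldMap_homotopic hu hv huv h)
  exact ⟨hST, p, h1.symm.trans (hp.comp (.refl (foldMap hu hv huv h)))⟩

/-! #### The realization as a mapping cone -/

/-- The map from the mapping cone on the inclusion of the link. -/
noncomputable def coneMap {v : V} (hv : v ∈ S) :
    C(MCone (indepIncl G (indepLink_subset G S v)), G.indepReal S) := by
  classical
  refine MCone.lift _ (indepIncl G Set.sdiff_subset) ⟨fun p => ⟨segment v p.1 p.2,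
    segment_mem_indepReal (fun w hw => hw.1) hv (fun w hw => hw.2.2) p.1.2 p.2.2⟩, ?_⟩
    ⟨Pi.single v 1, single_mem_indepReal hv⟩ ?_ ?_
  · exact Continuous.subtype_mk (by fun_prop) _
  · intro x; exact Subtype.ext (segment_zero v _)
  · intro x; refine Subtype.ext ?_; simp [segment]

lemma coneMap_cyl {v : V} (hv : v ∈ S) (x : G.indepReal (G.indepLink S v)) (t : I) :
    (coneMap hv (MCone.cyl _ (x, t))).1 = segment v x.1 t := rfl

open Classical in
lemma coneMap_apex {v : V} (hv : v ∈ S) :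
    (coneMap (G := G) hv (MCone.apex _)).1 = Pi.single v 1 := rfl

/-- The coordinate at `v` is the cone parameter `t`, and for `t ≠ 1` dividing the others by `1 - t`
recovers the point of the link. -/
lemma coneMap_injective {v : V} (hv : v ∈ S) : Function.Injective (coneMap (G := G) hv) := by
  classical
  have vA : ∀ a : G.indepReal (S \ {v}), a.1 v = 0 := fun a => a.2.2.2.1 v fun h => h.2 rfl
  have vL : ∀ a : G.indepReal (G.indepLink S v), a.1 v = 0 := fun a =>
    a.2.2.2.1 v fun h => h.2.1 rfl
  have c1 : ∀ a, (coneMap hv (MCone.inl _ a)).1 v = 0 := vA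
  have c2 : ∀ (y : G.indepReal (G.indepLink S v)) (t : I),
      (coneMap hv (MCone.cyl _ (y, t))).1 v = t := fun y t => by
    rw [coneMap_cyl, segment_apply_self, vL, mul_zero, zero_add]
  have c3 : (coneMap (G := G) hv (MCone.apex _)).1 v = 1 := by
    rw [coneMap_apex, Pi.single_eq_same]
  have d1 : ∀ a y t, coneMap hv (MCone.inl _ a) = coneMap hv (MCone.cyl _ (y, t)) →
      MCone.inl (indepIncl G (indepLink_subset G S v)) a = MCone.cyl _ (y, t) := by
    intro a y t h
    have ht : t = 0 := Subtype.ext ((c2 y t).symm.trans ((congrArg (fun z => z.1 v) h).symm.trans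
      (c1 a)))
    subst ht
    rw [MCone.cyl_zero]
    refine congrArg _ (Subtype.ext ?_)
    exact (congrArg Subtype.val h).trans (segment_zero v _)
  have d2 : ∀ y t, coneMap hv (MCone.cyl _ (y, t)) = coneMap hv (MCone.apex _) →
      MCone.cyl (indepIncl G (indepLink_subset G S v)) (y, t) = MCone.apex _ := by
    intro y t h
    have ht : t = 1 := Subtype.ext ((c2 y t).symm.trans ((congrArg (fun z => z.1 v) h).trans c3))
    subst ht
    exact MCone.cyl_one _ _
  have d3 : ∀ a, coneMap hv (MCone.inl _ a) ≠ coneMap (G := G) hv (MCone.apex _) := fun a h =>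
    zero_ne_one ((c1 a).symm.trans ((congrArg (fun z => z.1 v) h).trans c3))
  have d4 : ∀ y t y' t', coneMap hv (MCone.cyl _ (y, t)) = coneMap hv (MCone.cyl _ (y', t')) →
      MCone.cyl (indepIncl G (indepLink_subset G S v)) (y, t) = MCone.cyl _ (y', t') := by
    intro y t y' t' h
    obtain rfl : t = t' :=
      Subtype.ext ((c2 y t).symm.trans ((congrArg (fun z => z.1 v) h).trans (c2 y' t')))
    by_cases ht : t = 1
    · subst ht; rw [MCone.cyl_one, MCone.cyl_one]
    have ht' : 1 - (t : ℝ) ≠ 0 := fun e => ht (Subtype.ext (sub_eq_zero.1 e).symm)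
    obtain rfl : y = y' := by
      refine Subtype.ext (funext fun w => ?_)
      by_cases hw : w = v
      · subst hw; rw [vL, vL]
      have := congrArg (fun z => z.1 w) h
      simp only [coneMap_cyl, segment_apply_of_ne hw] at this
      exact mul_left_cancel₀ ht' this
    rfl
  refine MCone.ind (fun a => ?_) (fun y t => ?_) ?_
  · refine MCone.ind (fun a' h => ?_) (fun y' t' h => d1 _ _ _ h) (fun h => (d3 _ h).elim)
    exact congrArg _ (Subtype.ext (congrArg Subtype.val h :
      (coneMap hv (MCone.inl _ a)).1 = (coneMap hv (MCone.inl _ a')).1))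
  · exact MCone.ind (fun a' h => (d1 _ _ _ h.symm).symm) (fun y' t' h => d4 _ _ _ _ h)
      (fun h => d2 _ _ h)
  · exact MCone.ind (fun a' h => (d3 _ h.symm).elim) (fun y' t' h => (d2 _ _ h.symm).symm)
      (fun _ => rfl)

lemma coneMap_surjective {v : V} (hv : v ∈ S) : Function.Surjective (coneMap (G := G) hv) := by
  classical
  rintro ⟨x, hx⟩
  have hle : ∀ w, w ≠ v → x w ≤ 1 - x v := fun w hw => by
    have := Finset.sum_le_sum_of_subset_of_nonneg (f := x) (Finset.subset_univ {w, v})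
      fun i _ _ => hx.1 i
    rw [Finset.sum_pair hw, hx.2.1] at this
    linarith
  have hv1 : x v ≤ 1 := hx.2.1 ▸ Finset.single_le_sum (fun w _ => hx.1 w) (Finset.mem_univ v)
  by_cases h0 : x v = 0
  · refine ⟨MCone.inl _ ⟨x, hx.1, hx.2.1, fun w hw => ?_, hx.2.2.2⟩, rfl⟩
    by_cases hwv : w = v
    · rw [hwv, h0]
    · exact hx.2.2.1 w fun hw' => hw ⟨hw', hwv⟩
  by_cases h1 : x v = 1
  · refine ⟨MCone.apex _, Subtype.ext (funext fun w => ?_)⟩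
    rw [coneMap_apex]
    by_cases hwv : w = v
    · subst hwv; simp [h1]
    · rw [Pi.single_eq_of_ne hwv]
      have := hle w hwv; have := hx.1 w; simp only; linarith
  have hpos : 0 < 1 - x v := sub_pos.2 (lt_of_le_of_ne hv1 h1)
  -- The projection of `x` from the vertex `v` to the link.
  let y : V → ℝ := fun w => if w = v then 0 else x w / (1 - x v)
  have hyv : y v = 0 := if_pos rfl
  have hyw : ∀ w, w ≠ v → y w = x w / (1 - x v) := fun w hw => if_neg hw
  have hy : y ∈ G.indepReal (G.indepLink S v) := by
    refine ⟨fun w => ?_, ?_, fun w hw => ?_, fun a b hab => ?_⟩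
    · by_cases hw : w = v
      · rw [hw, hyv]
      · rw [hyw w hw]; exact div_nonneg (hx.1 w) hpos.le
    · have h2 := Finset.add_sum_erase Finset.univ x (Finset.mem_univ v)
      rw [← Finset.add_sum_erase Finset.univ y (Finset.mem_univ v), hyv, zero_add,
        Finset.sum_congr rfl fun w hw => hyw w (Finset.ne_of_mem_erase hw), ← Finset.sum_div,
        div_eq_one_iff_eq hpos.ne']
      rw [hx.2.1] at h2
      linarith
    · by_cases hwv : w = v
      · rw [hwv, hyv]
      rw [hyw w hwv]
      by_cases hwS : w ∈ S
      · have hadj : G.Adj v w := by by_contra hadj; exact hw ⟨hwS, hwv, hadj⟩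
        rw [(mul_eq_zero.1 (hx.2.2.2 v w hadj)).resolve_left h0, zero_div]
      · rw [hx.2.2.1 w hwS, zero_div]
    · by_cases ha : a = v
      · rw [ha, hyv, zero_mul]
      by_cases hb : b = v
      · rw [hb, hyv, mul_zero]
      rw [hyw a ha, hyw b hb, div_mul_div_comm, hx.2.2.2 a b hab, zero_div]
  refine ⟨MCone.cyl _ (⟨y, hy⟩, ⟨x v, hx.1 v, hv1⟩), Subtype.ext (funext fun w => ?_)⟩
  rw [coneMap_cyl]
  by_cases hwv : w = v
  · subst hwv; rw [segment_apply_self]; simp [hyv]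
  · rw [segment_apply_of_ne hwv]
    change (1 - x v) * y w = x w
    rw [hyw w hwv]
    field_simp

/-- The realization is the mapping cone of the inclusion of the link of a vertex. -/
noncomputable def coneHomeomorph {v : V} (hv : v ∈ S) :
    MCone (indepIncl G (indepLink_subset G S v)) ≃ₜ G.indepReal S :=
  Continuous.homeoOfEquivCompactToT2
    (f := Equiv.ofBijective (coneMap hv) ⟨coneMap_injective hv, coneMap_surjective hv⟩)
    (map_continuous (coneMap hv))

end SimpleGraph

/-! ### Ordered chains -/

namespace OrderedChain

variable {V : Type}

/-- The linear extension of putting the vertex `x` in front of an ordered simplex. -/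
noncomputable def cone (x : V) : (List V →₀ ℤ) →ₗ[ℤ] (List V →₀ ℤ) :=
  Finsupp.lmapDomain ℤ ℤ (List.cons x)

@[simp] lemma cone_single (x : V) (l : List V) (a : ℤ) :
    cone x (Finsupp.single l a) = Finsupp.single (x :: l) a := by
  simp [cone]

/-- The augmented boundary of an ordered simplex. -/
noncomputable def bdList : List V → (List V →₀ ℤ)
  | [] => 0
  | x :: l => Finsupp.single l 1 - cone x (bdList l)

/-- The augmented boundary of ordered chains. -/
noncomputable def bd : (List V →₀ ℤ) →ₗ[ℤ] (List V →₀ ℤ) := Finsupp.linearCombination ℤ bdList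

@[simp] lemma bd_single (l : List V) (a : ℤ) : bd (Finsupp.single l a) = a • bdList l := by
  simp [bd]

/-- Prepending a vertex is a contracting homotopy, in every degree because the empty list is kept as
a simplex. The vanishing of the homology of cones rests on this. -/
lemma bd_cone (x : V) (c : List V →₀ ℤ) : bd (cone x c) = c - cone x (bd c) := by
  induction c using Finsupp.induction_linear with
  | zero => simp
  | add c d hc hd => simp only [map_add, hc, hd]; abel
  | single l a => simp [bdList, smul_sub]

lemma bd_bdList (l : List V) : bd (bdList l) = 0 := by
  induction l with
  | nil => simp [bdList]
  | cons x l ih => simp [bdList, bd_cone, ih]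

lemma bd_bd (c : List V →₀ ℤ) : bd (bd c) = 0 := by
  induction c using Finsupp.induction_linear with
  | zero => simp
  | add c d hc hd => simp [hc, hd]
  | single l a => simp [bd_bdList]

lemma bdList_mem_supported (l : List V) :
    bdList l ∈ Finsupp.supported ℤ ℤ {l' : List V | l'.Sublist l} := by
  induction l with
  | nil => simp [bdList]
  | cons x l ih =>
    refine sub_mem ?_ ?_
    · exact Finsupp.single_mem_supported _ _ (List.sublist_cons_self x l)
    · rw [Finsupp.supported_eq_span_single] at ih
      refine Submodule.span_induction (p := fun c _ => cone x c ∈ Finsupp.supported ℤ ℤ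
        {l' : List V | l'.Sublist (x :: l)}) ?_ (by simp) ?_ ?_ ih
      · rintro _ ⟨l', hl', rfl⟩
        rw [cone_single]
        exact Finsupp.single_mem_supported _ _ (List.Sublist.cons_cons x hl')
      · intro c d _ _ hc hd; rw [map_add]; exact add_mem hc hd
      · intro a c _ hc; rw [map_smul]; exact Submodule.smul_mem _ _ hc

end OrderedChain

/-! ### Reduced homology of independence complexes by ordered chains -/

namespace SimpleGraph

open OrderedChain

variable {V : Type} (G : SimpleGraph V)

/-- The ordered simplices of the independence complex on `S`, including the empty one. -/
def indepLists (S : Set V) : Set (List V) :=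
  {l | (∀ x ∈ l, x ∈ S) ∧ ∀ x ∈ l, ∀ y ∈ l, ¬ G.Adj x y}

/-- The ordered chains of the independence complex on `S`. -/
noncomputable def indepChains (S : Set V) : Submodule ℤ (List V →₀ ℤ) :=
  Finsupp.supported ℤ ℤ (G.indepLists S)

variable {G} {S T : Set V}

lemma indepChains_mono (h : S ⊆ T) : G.indepChains S ≤ G.indepChains T :=
  Finsupp.supported_mono fun _ hl => ⟨fun x hx => h (hl.1 x hx), hl.2⟩

lemma map_mem_of_single_mem {s : Set (List V)} (f : (List V →₀ ℤ) →ₗ[ℤ] (List V →₀ ℤ))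
    {M : Submodule ℤ (List V →₀ ℤ)} (h : ∀ l ∈ s, f (Finsupp.single l 1) ∈ M)
    {c : List V →₀ ℤ} (hc : c ∈ Finsupp.supported ℤ ℤ s) : f c ∈ M := by
  rw [Finsupp.supported_eq_span_single] at hc
  have : Submodule.span ℤ ((fun i => Finsupp.single i (1 : ℤ)) '' s) ≤ M.comap f := by
    rw [Submodule.span_le]
    rintro _ ⟨l, hl, rfl⟩
    exact h l hl
  exact this hc

lemma bd_mem_indepChains {c : List V →₀ ℤ} (hc : c ∈ G.indepChains S) :
    bd c ∈ G.indepChains S := by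
  refine map_mem_of_single_mem bd (fun l hl => ?_) hc
  rw [bd_single, one_smul]
  refine Finsupp.supported_mono (fun l' hl' => ?_) (bdList_mem_supported l)
  exact ⟨fun x hx => hl.1 x (hl'.subset hx),
    fun x hx y hy => hl.2 x (hl'.subset hx) y (hl'.subset hy)⟩

lemma cone_mem_indepChains {u : V} (hST : S ⊆ T) (hu : u ∈ T) (h : ∀ w ∈ S, ¬ G.Adj u w)
    {c : List V →₀ ℤ} (hc : c ∈ G.indepChains S) : cone u c ∈ G.indepChains T := by
  refine map_mem_of_single_mem (cone u) (fun l hl => ?_) hc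
  rw [cone_single]
  refine Finsupp.single_mem_supported _ _ ⟨?_, ?_⟩
  · simp only [List.mem_cons, forall_eq_or_imp]
    exact ⟨hu, fun x hx => hST (hl.1 x hx)⟩
  · simp only [List.mem_cons, forall_eq_or_imp]
    exact ⟨⟨G.loopless.irrefl u, fun x hx => h x (hl.1 x hx)⟩,
      fun x hx => ⟨fun e => h x (hl.1 x hx) e.symm, hl.2 x hx⟩⟩

/-- The reduced homology of the independence complex on `S` is torsion-free. -/
def IndepTorsionFree (G : SimpleGraph V) (S : Set V) : Prop :=
  ∀ z ∈ G.indepChains S, ∀ n : ℤ, n ≠ 0 → (∃ w ∈ G.indepChains S, bd w = n • z) →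
    ∃ w ∈ G.indepChains S, bd w = z

/-- Cycles of the independence complex on `S` are boundaries in that on `T`. -/
def IndepNullhomologous (G : SimpleGraph V) (S T : Set V) : Prop :=
  ∀ z ∈ G.indepChains S, bd z = 0 → ∃ w ∈ G.indepChains T, bd w = z

lemma bd_eq_zero_of_smul {z w : List V →₀ ℤ} {n : ℤ} (hn : n ≠ 0) (h : bd w = n • z) :
    bd z = 0 := by
  have := bd_bd w
  rw [h, map_smul] at this
  exact (smul_eq_zero.1 this).resolve_left hn

lemma IndepNullhomologous.of_apex {u : V} (hST : S ⊆ T) (hu : u ∈ T) (h : ∀ w ∈ S, ¬ G.Adj u w) :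
    IndepNullhomologous G S T := fun z hz hz0 =>
  ⟨cone u z, cone_mem_indepChains hST hu h hz, by rw [bd_cone, hz0, map_zero, sub_zero]⟩

lemma IndepNullhomologous.mono {S' T' : Set V} (h : IndepNullhomologous G S T) (hS : S' ⊆ S)
    (hT : T ⊆ T') : IndepNullhomologous G S' T' := fun z hz hz0 => by
  obtain ⟨w, hw, e⟩ := h z (indepChains_mono hS hz) hz0
  exact ⟨w, indepChains_mono hT hw, e⟩

lemma indepTorsionFree_of_apex {u : V} (hu : u ∈ S) (h : ∀ w ∈ S, ¬ G.Adj u w) :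
    IndepTorsionFree G S := fun z hz _ hn ⟨_, _, hw⟩ =>
  IndepNullhomologous.of_apex subset_rfl hu h z hz (bd_eq_zero_of_smul hn hw)

/-- Only the empty list remains: the chains are `ℤ` in degree -1, with zero boundary. -/
lemma indepTorsionFree_empty : IndepTorsionFree G ∅ := by
  rintro z hz n hn ⟨w, hw, e⟩
  have h0 : bd w ∈ (⊥ : Submodule ℤ (List V →₀ ℤ)) := by
    refine map_mem_of_single_mem bd (fun l hl => ?_) hw
    obtain rfl : l = [] := List.eq_nil_iff_forall_not_mem.2 fun x hx => hl.1 x hx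
    simp [bdList]
  rw [Submodule.mem_bot] at h0
  rw [h0] at e
  exact ⟨0, zero_mem _, by rw [map_zero, (smul_eq_zero.1 e.symm).resolve_left hn]⟩

/-- The vertices of the closed star of `v` in the independence complex on `S`. -/
def indepStar (G : SimpleGraph V) (S : Set V) (v : V) : Set V := insert v (G.indepLink S v)

lemma indepStar_nullhomologous (G : SimpleGraph V) (S : Set V) (v : V) :
    IndepNullhomologous G (G.indepStar S v) (G.indepStar S v) :=
  .of_apex subset_rfl (Set.mem_insert _ _) (by
    rintro w (rfl | hw)
    · exact G.loopless.irrefl w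
    · exact hw.2.2)

lemma indepLink_subset_star (G : SimpleGraph V) (S : Set V) (v : V) :
    G.indepLink S v ⊆ G.indepStar S v := Set.subset_insert _ _

lemma indepStar_subset {v : V} (hv : v ∈ S) : G.indepStar S v ⊆ S :=
  Set.insert_subset hv fun _ hw => hw.1

/-- Simplices without `v` lie in the deletion, and those containing `v` lie in its star. Deletion
and star meet in the link, so this is the Mayer–Vietoris decomposition on chains. -/
lemma exists_split (v : V) {c : List V →₀ ℤ} (hc : c ∈ G.indepChains S) :
    ∃ a ∈ G.indepChains (S \ {v}), ∃ b ∈ G.indepChains (G.indepStar S v), c = a + b := by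
  classical
  refine ⟨c.filter fun l => v ∉ l, ?_, c.filter fun l => ¬ v ∉ l, ?_,
    (Finsupp.filter_add_filter_not c _).symm⟩
  · intro l hl
    simp only [Finsupp.support_filter, Finset.coe_filter, Set.mem_ofPred_eq] at hl
    have h := hc hl.1
    exact ⟨fun x hx => ⟨h.1 x hx, by rintro rfl; exact hl.2 hx⟩, h.2⟩
  · intro l hl
    simp only [Finsupp.support_filter, Finset.coe_filter, Set.mem_ofPred_eq, not_not] at hl
    have h := hc hl.1
    refine ⟨fun x hx => ?_, h.2⟩
    by_cases hxv : x = v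
    · exact Or.inl hxv
    · exact Or.inr ⟨h.1 x hx, hxv, h.2 v hl.2 x hx⟩

lemma mem_indepChains_link {v : V} {c : List V →₀ ℤ} (h1 : c ∈ G.indepChains (S \ {v}))
    (h2 : c ∈ G.indepChains (G.indepStar S v)) : c ∈ G.indepChains (G.indepLink S v) :=
  fun _ hl => ⟨fun x hx => ((h2 hl).1 x hx).resolve_left ((h1 hl).1 x hx).2, (h1 hl).2⟩

/-- If the link of `v` has torsion-free homology that vanishes in the deletion of `v`, and the
deletion has torsion-free homology, then so has the whole complex. -/
lemma IndepTorsionFree.of_link {v : V} (hv : v ∈ S) (hA : IndepTorsionFree G (S \ {v}))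
    (hL : IndepTorsionFree G (G.indepLink S v))
    (hn : IndepNullhomologous G (G.indepLink S v) (S \ {v})) : IndepTorsionFree G S := by
  have hAS : S \ {v} ⊆ S := Set.sdiff_subset
  rintro z hz n hn0 ⟨w, hw, e⟩
  have hz0 := bd_eq_zero_of_smul hn0 e
  obtain ⟨zA, hzA, zv, hzv, rfl⟩ := exists_split v hz
  obtain ⟨wA, hwA, wv, hwv, rfl⟩ := exists_split v hw
  rw [map_add] at hz0
  -- This is the image of `z` under the connecting map to the homology of the link.
  have hy : bd zv ∈ G.indepChains (G.indepLink S v) := by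
    refine mem_indepChains_link ?_ (bd_mem_indepChains hzv)
    rw [← neg_eq_of_add_eq_zero_right hz0]
    exact neg_mem (bd_mem_indepChains hzA)
  have hu : n • zv - bd wv ∈ G.indepChains (G.indepLink S v) := by
    refine mem_indepChains_link ?_
      (sub_mem (Submodule.smul_mem _ _ hzv) (bd_mem_indepChains hwv))
    have : n • zv - bd wv = bd wA - n • zA := by
      rw [map_add, smul_add] at e
      rw [sub_eq_sub_iff_add_eq_add, add_comm, ← e.symm, add_comm]
    rw [this]
    exact sub_mem (bd_mem_indepChains hwA) (Submodule.smul_mem _ _ hzA)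
  -- The connecting image of `z` is killed by `n` in the link, hence is zero there.
  obtain ⟨u, huL, hu⟩ := hL _ hy n hn0 ⟨_, hu, by rw [map_sub, bd_bd, sub_zero, map_smul]⟩
  obtain ⟨w', hw', e'⟩ := indepStar_nullhomologous G S v (zv - u)
    (sub_mem hzv (indepChains_mono (indepLink_subset_star G S v) huL)) (by rw [map_sub, hu, sub_self])
  have hzAu : zA + u ∈ G.indepChains (S \ {v}) :=
    add_mem hzA (indepChains_mono (indepLink_subset G S v) huL)
  -- Modulo `bd w'`, the cycle `z` has been replaced by `zA + u`, which avoids `v`.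
  have key : n • (zA + u) = bd (wA + wv - n • w') := by
    rw [map_sub, map_smul, e, e', ← smul_sub]
    congr 1; abel
  obtain ⟨xA, hxA, xv, hxv, hx⟩ := exists_split v (c := wA + wv - n • w')
    (sub_mem hw (Submodule.smul_mem _ _ (indepChains_mono (indepStar_subset hv) hw')))
  rw [hx, map_add] at key
  -- The part of the filling through `v` has its boundary in the link, so it can be exchanged for a
  -- chain `a` in the deletion.
  obtain ⟨a, ha, ea⟩ := hn (bd xv) (mem_indepChains_link (by
      rw [← sub_eq_iff_eq_add'.2 key]
      exact sub_mem (Submodule.smul_mem _ _ hzAu) (bd_mem_indepChains hxA))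
    (bd_mem_indepChains hxv)) (bd_bd _)
  obtain ⟨a', ha', ea'⟩ := hA _ hzAu n hn0 ⟨xA + a, add_mem hxA ha, by rw [map_add, ea, key]⟩
  refine ⟨a' + w', add_mem (indepChains_mono hAS ha')
    (indepChains_mono (indepStar_subset hv) hw'), ?_⟩
  rw [map_add, ea', e']; abel

/-- The link of a dominated vertex `v` is a cone with apex `u`, so a cycle can be pushed off `v`
through the star of `v`. -/
lemma IndepNullhomologous.of_dominated {u v : V} (hu : u ∈ S) (huv : u ≠ v) (hv : v ∈ S)
    (h : ∀ w ∈ S, G.Adj u w → G.Adj v w) (hST : S ⊆ T)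
    (hn : IndepNullhomologous G (S \ {v}) T) : IndepNullhomologous G S T := by
  have hadj : ¬ G.Adj v u := fun e => G.loopless.irrefl v (h v hv e.symm)
  have hL : IndepNullhomologous G (G.indepLink S v) (G.indepLink S v) :=
    .of_apex (u := u) subset_rfl ⟨hu, huv, hadj⟩ fun w hw e => hw.2.2 (h w hw.1 e)
  intro z hz hz0
  obtain ⟨zA, hzA, zv, hzv, rfl⟩ := exists_split v hz
  rw [map_add] at hz0
  have hy : bd zv ∈ G.indepChains (G.indepLink S v) := by
    refine mem_indepChains_link ?_ (bd_mem_indepChains hzv)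
    rw [← neg_eq_of_add_eq_zero_right hz0]
    exact neg_mem (bd_mem_indepChains hzA)
  obtain ⟨y, hyL, ey⟩ := hL _ hy (bd_bd _)
  obtain ⟨w', hw', e'⟩ := indepStar_nullhomologous G S v (zv - y)
    (sub_mem hzv (indepChains_mono (indepLink_subset_star G S v) hyL)) (by rw [map_sub, ey, sub_self])
  obtain ⟨a, ha, ea⟩ := hn (zA + y) (add_mem hzA (indepChains_mono (indepLink_subset G S v) hyL))
    (by rw [map_add, ey, hz0])
  refine ⟨a + w', add_mem ha (indepChains_mono ((indepStar_subset hv).trans hST) hw'), ?_⟩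
  rw [map_add, ea, e']; abel

end SimpleGraph

/-! ### Comparison with simplicial homology -/

open CategoryTheory

namespace OrderedChain

variable {V : Type}

/-- Unwinding the recursion gives the alternating sum of faces, which links `bd` with the simplicial
differential. -/
lemma bdList_ofFn : ∀ {n : ℕ} (f : Fin (n + 1) → V), bdList (List.ofFn f) =
    ∑ i : Fin (n + 1), (-1 : ℤ) ^ (i : ℕ) • Finsupp.single (List.ofFn fun j => f (i.succAbove j)) 1
  | 0, f => by simp [bdList]
  | n + 1, f => by
    rw [List.ofFn_succ, bdList, bdList_ofFn, Fin.sum_univ_succ (n := n + 1), map_sum]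
    simp only [Fin.val_zero, pow_zero, one_smul, Fin.zero_succAbove, sub_eq_add_neg,
      ← Finset.sum_neg_distrib]
    congr 1
    refine Finset.sum_congr rfl fun i _ => ?_
    rw [map_zsmul, cone_single, List.ofFn_succ (f := fun j => f (i.succ.succAbove j))]
    simp only [Fin.succ_succAbove_zero, Fin.succ_succAbove_succ, Fin.val_succ, pow_succ]
    simp

lemma bdList_mem_supported_length (l : List V) :
    bdList l ∈ Finsupp.supported ℤ ℤ {l' : List V | l'.length + 1 = l.length} := by
  rcases l with _ | ⟨x, l⟩
  · simp [bdList]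
  · obtain ⟨n, f, e⟩ : ∃ (n : ℕ) (f : Fin (n + 1) → V), x :: l = List.ofFn f :=
      ⟨l.length, (x :: l).get, (List.ofFn_get _).symm⟩
    rw [e, bdList_ofFn]
    exact sum_mem fun i _ => Submodule.smul_mem _ _
      (Finsupp.single_mem_supported _ _ (by simp))

end OrderedChain

namespace SimpleGraph

open OrderedChain

variable {V : Type} (G : SimpleGraph V)

/-- The simplicial set of ordered simplices of the independence complex. -/
abbrev indepSSet : SSet.{0} := G.independenceComplex.orderedSimplices

/-- The ordered simplices of dimension `n` of the independence complex. -/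
abbrev IndepSimplex (n : ℕ) : Type := G.indepSSet.obj (Opposite.op (SimplexCategory.mk n))

variable {G}

/-- The list of vertices of an ordered simplex. -/
def toList {n : ℕ} (x : G.IndepSimplex n) : List V := List.ofFn (n := n + 1) x.1

lemma toList_injective {n : ℕ} : Function.Injective (toList (G := G) (n := n)) := fun _ _ h =>
  Subtype.ext (List.ofFn_injective (α := V) (n := n + 1) h)

lemma toList_mem {n : ℕ} (x : G.IndepSimplex n) : toList x ∈ G.indepLists Set.univ := by
  obtain ⟨s, hs, h⟩ := x.2
  refine ⟨fun _ _ => Set.mem_univ _, ?_⟩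
  have key : ∀ v ∈ toList x, v ∈ s := by
    intro v hv
    obtain ⟨i, rfl⟩ := (List.mem_ofFn' _ _).1 hv
    exact h i
  intro v hv w hw hvw
  exact hs.2 (key v hv) (key w hw) hvw.ne hvw

lemma exists_toList_eq {n : ℕ} {l : List V} (hl : l ∈ G.indepLists Set.univ)
    (hn : l.length = n + 1) : ∃ x : G.IndepSimplex n, toList x = l := by
  classical
  have hlen : ∃ f : Fin (n + 1) → V, List.ofFn f = l := by
    refine ⟨fun i => l.get (i.cast hn.symm), ?_⟩
    rw [← List.ofFn_congr hn l.get, List.ofFn_get]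
  obtain ⟨f, rfl⟩ := hlen
  refine ⟨⟨f, Finset.univ.image f, ⟨⟨f 0, by simp⟩, ?_⟩, fun i => by simp⟩, rfl⟩
  intro v hv w hw _ hvw
  simp only [Finset.coe_image, Finset.coe_univ, Set.image_univ, Set.mem_range] at hv hw
  exact hl.2 v ((List.mem_ofFn' _ _).2 hv) w ((List.mem_ofFn' _ _).2 hw) hvw

lemma toList_δ {n : ℕ} (x : G.IndepSimplex (n + 1)) (i : Fin (n + 2)) :
    toList (G.indepSSet.δ i x) = List.ofFn (n := n + 1) fun j => x.1 (i.succAbove j) := rfl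

variable (G)

/-- The simplicial chain complex of the independence complex. -/
noncomputable abbrev chainCx : ChainComplex (ModuleCat.{0} ℤ) ℕ :=
  G.indepSSet.chainComplex (ModuleCat.of ℤ ℤ)

variable {G}

/-- The generator of the chain module given by an ordered simplex. -/
noncomputable def gen {n : ℕ} (x : G.IndepSimplex n) : G.chainCx.X n :=
  (G.indepSSet.ιChainComplex (R := ModuleCat.of ℤ ℤ) x).hom (1 : ℤ)

lemma d_gen {n : ℕ} (x : G.IndepSimplex (n + 1)) : (G.chainCx.d (n + 1) n).hom (gen x) =
    ∑ i : Fin (n + 2), (-1 : ℤ) ^ (i : ℕ) • gen (G.indepSSet.δ i x) := by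
  refine (congrArg (fun f => f.hom (1 : ℤ))
    (SSet.ιChainComplex_d G.indepSSet (ModuleCat.of ℤ ℤ) x)).trans ?_
  simp only [ModuleCat.hom_sum, LinearMap.sum_apply, ModuleCat.hom_zsmul]
  rfl

variable (G) in
/-- The map from the simplicial chains to the ordered chains. -/
noncomputable def toChains (n : ℕ) : G.chainCx.X n →ₗ[ℤ] (List V →₀ ℤ) :=
  (Limits.Sigma.desc (f := fun _ : G.IndepSimplex n => ModuleCat.of ℤ ℤ)
    fun x => ModuleCat.ofHom (Finsupp.lsingle (toList x) : ℤ →ₗ[ℤ] (List V →₀ ℤ))).hom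

lemma toChains_gen {n : ℕ} (x : G.IndepSimplex n) :
    G.toChains n (gen x) = Finsupp.single (toList x) 1 := by
  have h : G.indepSSet.ιChainComplex (R := ModuleCat.of ℤ ℤ) x ≫
      ModuleCat.ofHom (G.toChains n) =
      ModuleCat.ofHom (Finsupp.lsingle (toList x) : ℤ →ₗ[ℤ] (List V →₀ ℤ)) :=
    Limits.Sigma.ι_desc _ _
  exact congrArg (fun f => f.hom (1 : ℤ)) h

lemma hom_eq_of_gen {n : ℕ} {M : Type} [AddCommGroup M] [Module ℤ M] (f g : G.chainCx.X n →ₗ[ℤ] M)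
    (h : ∀ x, f (gen x) = g (gen x)) : f = g := by
  have : ModuleCat.ofHom f = ModuleCat.ofHom g := by
    refine SSet.chainComplex_hom_ext fun x => ?_
    refine ModuleCat.hom_ext (LinearMap.ext_ring ?_)
    exact h x
  exact congrArg ModuleCat.Hom.hom this

open Classical in
variable (G) in
/-- The projection of the ordered chains to the simplicial chains of a given degree. -/
noncomputable def ofChains (n : ℕ) : (List V →₀ ℤ) →ₗ[ℤ] G.chainCx.X n :=
  Finsupp.linearCombination ℤ fun l =>
    if h : ∃ x : G.IndepSimplex n, toList x = l then gen h.choose else 0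

lemma ofChains_single {n : ℕ} (x : G.IndepSimplex n) :
    G.ofChains n (Finsupp.single (toList x) 1) = gen x := by
  have h : ∃ y : G.IndepSimplex n, toList y = toList x := ⟨x, rfl⟩
  simp only [ofChains, Finsupp.linearCombination_single, dif_pos h]
  rw [toList_injective h.choose_spec]
  exact @one_smul ℤ (G.chainCx.X n) _ (G.chainCx.X n).isModule.toMulAction (gen x)

lemma ofChains_single_of_length {n : ℕ} {l : List V} (hl : l.length ≠ n + 1) :
    G.ofChains n (Finsupp.single l 1) = 0 := by
  have h : ¬ ∃ y : G.IndepSimplex n, toList y = l := by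
    rintro ⟨y, rfl⟩; exact hl (List.length_ofFn)
  simp only [ofChains, Finsupp.linearCombination_single, dif_neg h]
  exact smul_zero _

lemma ofChains_toChains {n : ℕ} (z : G.chainCx.X n) : G.ofChains n (G.toChains n z) = z := by
  have : (G.ofChains n).comp (G.toChains n) = LinearMap.id :=
    hom_eq_of_gen _ _ fun x => by
      rw [LinearMap.comp_apply, toChains_gen, ofChains_single]; rfl
  exact congrArg (fun f => f z) this

lemma toChains_d {n : ℕ} (w : G.chainCx.X (n + 1)) :
    G.toChains n ((G.chainCx.d (n + 1) n).hom w) = bd (G.toChains (n + 1) w) := by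
  have : (G.toChains n).comp (G.chainCx.d (n + 1) n).hom =
      bd.comp (G.toChains (n + 1)) := by
    refine hom_eq_of_gen _ _ fun x => ?_
    simp only [LinearMap.comp_apply, d_gen, map_sum, map_zsmul, toChains_gen, bd_single, one_smul,
      toList_δ]
    exact (bdList_ofFn (n := n + 1) x.1).symm
  exact congrArg (fun f => f w) this

lemma toChains_mem {n : ℕ} (z : G.chainCx.X n) :
    G.toChains n z ∈ G.indepChains Set.univ := by
  have : (G.indepChains Set.univ).mkQ.comp (G.toChains n) = 0 :=
    hom_eq_of_gen _ _ fun x => by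
      simp only [LinearMap.comp_apply, toChains_gen, LinearMap.zero_apply, Submodule.mkQ_apply,
        Submodule.Quotient.mk_eq_zero]
      exact Finsupp.single_mem_supported _ _ (toList_mem x)
  exact (Submodule.Quotient.mk_eq_zero _).1 (congrArg (fun f => f z) this)

/-- The boundary shortens every list by exactly one, so it is compatible with projecting to a single
degree; this turns inhomogeneous fillings into simplicial ones. -/
lemma d_ofChains {n : ℕ} {c : List V →₀ ℤ} (hc : c ∈ G.indepChains Set.univ) :
    (G.chainCx.d (n + 1) n).hom (G.ofChains (n + 1) c) = G.ofChains n (bd c) := by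
  rw [indepChains, Finsupp.supported_eq_span_single] at hc
  have key : Set.EqOn ((G.chainCx.d (n + 1) n).hom.comp (G.ofChains (n + 1)))
      ((G.ofChains n).comp bd)
      (Submodule.span ℤ ((fun l => Finsupp.single l (1 : ℤ)) '' G.indepLists Set.univ)) := by
    refine LinearMap.eqOn_span ?_
    rintro _ ⟨l, hl, rfl⟩
    simp only [LinearMap.comp_apply, bd_single, one_smul]
    by_cases hn : l.length = n + 2
    · obtain ⟨x, rfl⟩ := exists_toList_eq hl hn
      rw [ofChains_single, d_gen, toList, bdList_ofFn (n := n + 1) x.1, map_sum]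
      refine Finset.sum_congr rfl fun i _ => ?_
      rw [map_zsmul, ← toList_δ, ofChains_single]
    · rw [ofChains_single_of_length hn, map_zero]
      have h := bdList_mem_supported_length l
      rw [Finsupp.supported_eq_span_single] at h
      have h0 : Submodule.span ℤ ((fun l => Finsupp.single l (1 : ℤ)) ''
          {l' : List V | l'.length + 1 = l.length}) ≤ LinearMap.ker (G.ofChains n) := by
        rw [Submodule.span_le]
        rintro _ ⟨l', hl', rfl⟩
        refine ofChains_single_of_length fun e => hn ?_
        rw [← show l'.length + 1 = l.length from hl', e]
      exact (h0 h).symm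
  exact key hc

/-- Torsion-freeness of the ordered chain homology gives that of the simplicial homology. -/
theorem isTorsionFree_integralHomology (h : IndepTorsionFree G Set.univ) (q : ℕ) :
    Module.IsTorsionFree ℤ (G.independenceComplex.integralHomology q) := by
  -- Homology embeds in chains modulo boundaries, and already this larger quotient is torsion-free.
  -- Only boundaries from degree `q + 1` matter, so the augmentation does no harm in degree 0.
  have key : ∀ (n : ℤ), n ≠ 0 → ∀ y : G.chainCx.opcycles q, n • y = 0 → y = 0 := by
    intro n hn y hy
    have hex : (ShortComplex.mk (G.chainCx.d (q + 1) q) (G.chainCx.pOpcycles q) (by simp)).Exact :=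
      ShortComplex.exact_of_g_is_cokernel _ (G.chainCx.opcyclesIsCokernel (q + 1) q (by simp))
    obtain ⟨z, rfl⟩ := (ModuleCat.epi_iff_surjective (G.chainCx.pOpcycles q)).1 inferInstance y
    obtain ⟨w, hw⟩ := (ShortComplex.moduleCat_exact_iff _).1 hex (n • z)
      (by simpa using hy)
    obtain ⟨c, hc, e⟩ := h (G.toChains q z) (toChains_mem z) n hn
      ⟨G.toChains (q + 1) w, toChains_mem w, by
        rw [← toChains_d, ← map_zsmul]; exact congrArg _ hw⟩
    have hz : (G.chainCx.d (q + 1) q).hom (G.ofChains (q + 1) c) = z := by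
      rw [d_ofChains hc, e, ofChains_toChains]
    rw [← hz]
    exact congrArg (fun f => f.hom (G.ofChains (q + 1) c)) (G.chainCx.d_pOpcycles (q + 1) q)
  refine ⟨fun n hn => ?_⟩
  have hinj := (ModuleCat.mono_iff_injective (G.chainCx.homologyι q)).1 inferInstance
  have hker : ∀ x : G.chainCx.homology q, n • x = 0 → x = 0 := fun x hx => hinj (by
    rw [map_zero]
    refine key n hn.ne_zero _ ?_
    rw [← map_zsmul, hx, map_zero])
  intro x y hxy
  have hxy' : n • (x : G.chainCx.homology q) = n • (y : G.chainCx.homology q) :=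
    (int_smul_eq_zsmul _ n x).symm.trans (Eq.trans hxy (int_smul_eq_zsmul _ n y))
  exact sub_eq_zero.1 (hker _ ((zsmul_sub _ _ n).trans (sub_eq_zero.2 hxy')))

end SimpleGraph

/-! ### Homotopy and homology combined: removing vertices and edges -/

namespace SimpleGraph

variable {V : Type} [Fintype V] {G : SimpleGraph V} {S T : Set V} {c : ℕ}

/-- The independence complex on `S` has torsion-free homology and is a homotopy wedge of spheres of
dimensions `≥ c - 1`, where the empty complex counts as a sphere of dimension `-1`. -/
def IndepGood (G : SimpleGraph V) (c : ℕ) (S : Set V) : Prop :=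
  IndepTorsionFree G S ∧ ((c = 0 ∧ S = ∅) ∨ IsHomotopySphereWedge c (G.indepReal S))

/-- The inclusion of the independence complex on `S` in that on `T` is trivial up to homotopy and
in homology. -/
def IndepNull (G : SimpleGraph V) (S T : Set V) : Prop :=
  IndepNullhomotopic G S T ∧ IndepNullhomologous G S T

lemma IndepNull.of_apex {u : V} (hST : S ⊆ T) (hu : u ∈ T) (h : ∀ w ∈ S, ¬ G.Adj u w) :
    IndepNull G S T := ⟨.of_apex hST hu h, .of_apex hST hu h⟩

lemma IndepNull.mono {S' T' : Set V} (h : IndepNull G S T) (hS : S' ⊆ S) (hT : T ⊆ T') :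
    IndepNull G S' T' := ⟨h.1.mono hS hT, h.2.mono hS hT⟩

lemma indepGood_empty : IndepGood G 0 ∅ := ⟨indepTorsionFree_empty, Or.inl ⟨rfl, rfl⟩⟩

lemma IndepGood.mono {c' : ℕ} (h : IndepGood G c S) (hc : c' ≤ c) : IndepGood G c' S :=
  ⟨h.1, h.2.imp (fun e => ⟨by omega, e.2⟩) fun e => e.mono hc⟩

lemma indepGood_of_apex {u : V} (hu : u ∈ S) (h : ∀ w ∈ S, ¬ G.Adj u w) : IndepGood G c S :=
  have := contractibleSpace_indepReal hu h
  ⟨indepTorsionFree_of_apex hu h, Or.inr .of_contractible⟩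

/-- Induction on the removal of dominated vertices. -/
lemma dominated_induction {P : Set V → Prop}
    (hP : ∀ (S : Set V) (u v : V), u ∈ S → v ∈ S → u ≠ v → (∀ w ∈ S, G.Adj u w → G.Adj v w) →
      P (S \ {v}) → P S)
    {D : Set V} (hDS : D ⊆ S) (hD : ∀ v ∈ D, ∃ u ∈ S, u ∉ D ∧ ∀ w ∈ S, G.Adj u w → G.Adj v w)
    (h : P (S \ D)) : P S := by
  induction D, D.toFinite using Set.Finite.induction_on generalizing S with
  | empty => simpa using h
  | @insert a D ha _ ih =>
    obtain ⟨u, hu, huD, hdom⟩ := hD a (Set.mem_insert _ _)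
    refine hP S u a hu (hDS (Set.mem_insert _ _)) (fun e => huD (e ▸ Set.mem_insert _ _)) hdom ?_
    -- The dominating vertices lie outside the removed set, so they survive the removal of `a`.
    refine ih (fun v hv => ⟨hDS (Set.mem_insert_of_mem _ hv), fun e => ha (e ▸ hv)⟩) ?_ ?_
    · intro v hv
      obtain ⟨u, hu, huD, hdom⟩ := hD v (Set.mem_insert_of_mem _ hv)
      exact ⟨u, ⟨hu, fun e => huD (Or.inl e)⟩, fun e => huD (Or.inr e), fun w hw => hdom w hw.1⟩
    · rwa [Set.sdiff_sdiff, Set.singleton_union]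

lemma IndepNull.of_dominated {D : Set V} (hST : S ⊆ T) (hDS : D ⊆ S)
    (hD : ∀ v ∈ D, ∃ u ∈ S, u ∉ D ∧ ∀ w ∈ S, G.Adj u w → G.Adj v w)
    (h : IndepNull G (S \ D) T) : IndepNull G S T := by
  refine dominated_induction (P := fun S => S ⊆ T → IndepNull G S T) ?_ hDS hD (fun _ => h) hST
  intro S u v hu hv huv hdom hn hST
  have hn := hn (Set.sdiff_subset.trans hST)
  exact ⟨.of_dominated hu hv huv hdom hST hn.1, .of_dominated hu huv hv hdom hST hn.2⟩

lemma IndepGood.of_link_of_pathConnected {v : V} (hv : v ∈ S)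
    (hA : IndepGood G (c + 1) (S \ {v})) [PathConnectedSpace (G.indepReal (S \ {v}))]
    (hL : IndepGood G c (G.indepLink S v)) (hn : IndepNull G (G.indepLink S v) (S \ {v})) :
    IndepGood G (c + 1) S := by
  refine ⟨hA.1.of_link hv hL.1 hn.2, Or.inr ?_⟩
  obtain ⟨h, p, hp⟩ := hn.1
  have hX := hA.2.resolve_left fun e => Nat.succ_ne_zero c e.1
  refine IsHomotopySphereWedge.of_homotopyEquiv (IsHomotopySphereWedge.mCone hX
    (hL.2.imp_left fun e => ⟨e.1, ?_⟩) (indepIncl G h) ⟨p, hp⟩)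
    (coneHomeomorph hv).symm.toHomotopyEquiv
  rw [e.2]
  exact isEmpty_indepReal

/-- The bound `c + 2` makes all spheres of the deletion at least one-dimensional, so the deletion is
automatically path connected. -/
lemma IndepGood.of_link {v : V} (hv : v ∈ S) (hA : IndepGood G (c + 2) (S \ {v}))
    (hL : IndepGood G (c + 1) (G.indepLink S v))
    (hn : IndepNull G (G.indepLink S v) (S \ {v})) : IndepGood G (c + 2) S :=
  have := (hA.2.resolve_left fun e => Nat.succ_ne_zero _ e.1).pathConnectedSpace (by omega)
  of_link_of_pathConnected hv hA hL hn

lemma IndepGood.of_dominated {D : Set V} (hDS : D ⊆ S)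
    (hD : ∀ v ∈ D, ∃ u ∈ S, u ∉ D ∧ ∀ w ∈ S, G.Adj u w → G.Adj v w)
    (h : IndepGood G c (S \ D)) : IndepGood G c S := by
  refine dominated_induction (P := fun S => IndepGood G c S) ?_ hDS hD h
  intro S u v hu hv huv hdom h
  have hadj : ¬ G.Adj v u := fun e => G.loopless.irrefl v (hdom v hv e.symm)
  -- The link of `v` is a cone with apex `u`.
  have hL : ∀ w ∈ G.indepLink S v, ¬ G.Adj u w := fun w hw e => hw.2.2 (hdom w hw.1 e)
  refine ⟨h.1.of_link hv (indepTorsionFree_of_apex (u := u) ⟨hu, huv, hadj⟩ hL)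
    (.of_apex (u := u) (indepLink_subset G S v) ⟨hu, huv⟩ hL), Or.inr ?_⟩
  refine (h.2.resolve_left fun e => ?_).of_homotopyEquiv (foldEquiv hu hv huv hdom)
  exact (e.2 ▸ (⟨hu, huv⟩ : u ∈ S \ {v}) : u ∈ (∅ : Set V))

/-- Removing an isolated edge amounts to a desuspension. -/
lemma IndepGood.of_edge {a b : V} (ha : a ∈ S) (hb : b ∈ S) (hab : G.Adj a b)
    (ha' : ∀ w ∈ S, G.Adj a w → w = b) (hb' : ∀ w ∈ S, G.Adj b w → w = a)
    (h : IndepGood G c (S \ {a, b})) : IndepGood G (c + 1) S := by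
  have hlink : G.indepLink S a = S \ {a, b} := by
    ext w
    simp only [indepLink, Set.mem_ofPred_eq, Set.mem_sdiff, Set.mem_insert_iff,
      Set.mem_singleton_iff, not_or]
    refine ⟨fun hw => ⟨hw.1, hw.2.1, ?_⟩, fun hw => ⟨hw.1, hw.2.1, fun e => hw.2.2 (ha' w hw.1 e)⟩⟩
    rintro rfl; exact hw.2.2 hab
  have hbA : b ∈ S \ {a} := ⟨hb, hab.ne'⟩
  have hbA' : ∀ w ∈ S \ {a}, ¬ G.Adj b w := fun w hw e => hw.2 (hb' w hw.1 e)
  -- Without `a` the vertex `b` is isolated, so the deletion is a cone; the mapping cone is then the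
  -- suspension of the link.
  have := contractibleSpace_indepReal hbA hbA'
  refine of_link_of_pathConnected ha (indepGood_of_apex hbA hbA') (hlink ▸ h) ?_
  exact .of_apex (indepLink_subset G S a) hbA fun w hw =>
    hbA' w (indepLink_subset G S a hw)

/-- Every isolated edge contributes one suspension and raises the dimension bound by one. -/
lemma IndepGood.of_edges {κ : Type} [Finite κ] {a b : κ → V} (ha : ∀ k, a k ∈ S)
    (hb : ∀ k, b k ∈ S) (hab : ∀ k, G.Adj (a k) (b k)) (ha' : ∀ k, ∀ w ∈ S, G.Adj (a k) w → w = b k)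
    (hb' : ∀ k, ∀ w ∈ S, G.Adj (b k) w → w = a k) (hainj : a.Injective) (hbinj : b.Injective)
    (hne : ∀ k l, a k ≠ b l) (h : IndepGood G c (S \ (Set.range a ∪ Set.range b))) :
    IndepGood G (c + Nat.card κ) S := by
  have := Fintype.ofFinite κ
  classical
  suffices H : ∀ (K : Finset κ) (S : Set V), (∀ k ∈ K, a k ∈ S) → (∀ k ∈ K, b k ∈ S) →
      (∀ k, ∀ w ∈ S, G.Adj (a k) w → w = b k) → (∀ k, ∀ w ∈ S, G.Adj (b k) w → w = a k) →
      IndepGood G c (S \ (a '' K ∪ b '' K)) → IndepGood G (c + K.card) S by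
    have := H Finset.univ S (fun k _ => ha k) (fun k _ => hb k) ha' hb'
      (by simpa [Set.image_univ] using h)
    rwa [Finset.card_univ, ← Nat.card_eq_fintype_card] at this
  intro K
  induction K using Finset.induction_on with
  | empty => intro S _ _ _ _ h; simpa using h
  | insert k K hk ih =>
    intro S ha hb ha' hb' h
    rw [Finset.card_insert_of_notMem hk, ← add_assoc]
    refine of_edge (ha k (by simp)) (hb k (by simp)) (hab k) (ha' k) (hb' k) ?_
    refine ih _ (fun l hl => ⟨ha l (by simp [hl]), ?_⟩) (fun l hl => ⟨hb l (by simp [hl]), ?_⟩)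
      (fun l w hw => ha' l w hw.1) (fun l w hw => hb' l w hw.1) ?_
    · rintro (e | e)
      · exact hk (hainj e ▸ hl)
      · exact hne _ _ e
    · rintro (e | e)
      · exact hne _ _ e.symm
      · exact hk (hbinj e ▸ hl)
    · convert h using 1
      rw [Set.sdiff_sdiff]
      congr 1
      ext x
      simp only [Set.mem_union, Set.mem_insert_iff, Set.mem_singleton_iff, Set.mem_image,
        Finset.coe_insert, Finset.mem_coe, exists_eq_or_imp, eq_comm (a := x)]
      exact or_or_or_comm

end SimpleGraph

/-! ### The induction over the tails of `Δ^m_n` -/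

open SimpleGraph

namespace DeltaGraph

variable {m n : ℕ}

/-- The set of the vertices `e_j` with `E j` and `f_j^k` with `F j k`, numbered from `0`. -/
def vset (m n : ℕ) (E : ℕ → Prop) (F : ℕ → ℕ → Prop) : Set (Fin n ⊕ (Fin (n - 1) × Fin m)) :=
  {x | Sum.elim (fun j : Fin n => E j) (fun p : Fin (n - 1) × Fin m => F p.1 p.2) x}

@[simp] lemma inl_mem {E : ℕ → Prop} {F : ℕ → ℕ → Prop} {j : Fin n} :
    Sum.inl j ∈ vset m n E F ↔ E j := Iff.rfl

@[simp] lemma inr_mem {E : ℕ → Prop} {F : ℕ → ℕ → Prop} {p : Fin (n - 1) × Fin m} :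
    Sum.inr p ∈ vset m n E F ↔ F p.1 p.2 := Iff.rfl

@[simp] lemma adj_inl_inl {i j : Fin n} : ¬ (deltaGraph m n).Adj (Sum.inl i) (Sum.inl j) :=
  fun h => h

@[simp] lemma adj_inl_inr {j : Fin n} {p : Fin (n - 1) × Fin m} :
    (deltaGraph m n).Adj (Sum.inl j) (Sum.inr p) ↔ (j : ℕ) = p.1 ∨ (j : ℕ) = p.1 + 1 := Iff.rfl

@[simp] lemma adj_inr_inl {j : Fin n} {p : Fin (n - 1) × Fin m} :
    (deltaGraph m n).Adj (Sum.inr p) (Sum.inl j) ↔ (j : ℕ) = p.1 ∨ (j : ℕ) = p.1 + 1 := Iff.rfl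

@[simp] lemma adj_inr_inr {p r : Fin (n - 1) × Fin m} :
    (deltaGraph m n).Adj (Sum.inr p) (Sum.inr r) ↔
      p.2 = r.2 ∧ ((r.1 : ℕ) = p.1 + 1 ∨ (p.1 : ℕ) = r.1 + 1) := Iff.rfl

/-- The vertices `e_j` and `f_j^k` with `j ≥ i`. -/
def tail (m n i : ℕ) : Set (Fin n ⊕ (Fin (n - 1) × Fin m)) := 
  vset m n (fun j => i ≤ j) (fun j _ => i ≤ j)

/-- The vertex `e_j`. -/
def e (m : ℕ) (j : ℕ) (h : j < n) : Fin n ⊕ (Fin (n - 1) × Fin m) := Sum.inl ⟨j, h⟩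

/-- The vertex `f_j^k`. -/
def f (j : ℕ) (h : j + 1 < n) (k : Fin m) : Fin n ⊕ (Fin (n - 1) × Fin m) :=
  Sum.inr (⟨j, by omega⟩, k)

lemma f_injective (j : ℕ) (h : j + 1 < n) : (f (m := m) j h).Injective := fun k l hkl => by
  simpa [f] using hkl

lemma good_of_edges {c i : ℕ} (hi : i + 2 < n)
    (h : IndepGood (deltaGraph m n) c (tail m n (i + 3))) :
    IndepGood (deltaGraph m n) (c + m)
      (vset m n (fun j => i + 3 ≤ j) (fun j _ => j = i ∨ j = i + 1 ∨ i + 3 ≤ j)) := by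
  set S := vset m n (fun j => i + 3 ≤ j) (fun j _ => j = i ∨ j = i + 1 ∨ i + 3 ≤ j) with hS
  have hs : S \ (Set.range (f (m := m) i (by omega)) ∪
      Set.range (f (m := m) (i + 1) hi)) = tail m n (i + 3) := by
    ext (l | ⟨l, k⟩)
    · simp [hS, tail, f]
    · simp [hS, tail, f, Fin.ext_iff]; omega
  have := IndepGood.of_edges (κ := Fin m) (S := S) (G := deltaGraph m n) (c := c)
    (a := f i (by omega)) (b := f (i + 1) hi) ?_ ?_ ?_ ?_ ?_ (f_injective _ _) (f_injective _ _) ?_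
    (hs ▸ h)
  · simpa using this
  · intro k; simp [f, hS]
  · intro k; simp [f, hS]
  · intro k; simp [f]
  · rintro k (l | ⟨l, k'⟩) hl
    · simp [hS] at hl; simp [f]; omega
    · simp [hS] at hl; simp [f, Fin.ext_iff]; omega
  · rintro k (l | ⟨l, k'⟩) hl
    · simp [hS] at hl; simp [f]; omega
    · simp [hS] at hl; simp [f, Fin.ext_iff]; omega
  · intro k l; simp [f]

/-- The suspension of the tail by the star of `e_i`. -/
lemma good_star {i : ℕ} (hm : 0 < m) (hi : i + 1 < n)
    (h : IndepGood (deltaGraph m n) 0 (tail m n (i + 3))) :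
    IndepGood (deltaGraph m n) 1
      (vset m n (fun j => j = i ∨ i + 3 ≤ j) (fun j _ => j = i ∨ i + 3 ≤ j)) := by
  -- Here every `f_i^k` has `e_i` as its only neighbour, so one of them suffices; with `e_i` it
  -- forms an isolated edge.
  refine IndepGood.of_dominated (D := vset m n (fun _ => False) (fun j k => j = i ∧ k ≠ 0)) ?_ ?_ ?_
  · rintro (l | ⟨l, k⟩) hl <;> simp at hl ⊢; omega
  · rintro (l | ⟨l, k⟩) hl
    · simp at hl
    refine ⟨f i hi ⟨0, hm⟩, by simp [f], by simp [f], ?_⟩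
    rintro (l' | ⟨l', k'⟩) hl' <;> simp [f] at hl hl' ⊢ <;> omega
  · refine IndepGood.of_edge (a := e m i (by omega)) (b := f i hi ⟨0, hm⟩) ?_ ?_ ?_ ?_ ?_ ?_
    · simp [e]
    · simp [f]
    · simp [e, f]
    · rintro (l | ⟨l, k'⟩) hl <;> simp [e, f, Fin.ext_iff] at hl ⊢; omega
    · rintro (l | ⟨l, k'⟩) hl <;> simp [e, f, Fin.ext_iff] at hl ⊢ <;> omega
    · convert h using 1
      ext (l | ⟨l, k⟩) <;> simp [e, f, tail, Fin.ext_iff] <;> omega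

/-- The complex on the vertices `f_j^k` with `j ≥ i` and `e_j` with `j ≥ i + 3`. -/
lemma good_deletion {i : ℕ} (hi : i + 2 < n)
    (h : IndepGood (deltaGraph m n) 0 (tail m n (i + 3))) :
    IndepGood (deltaGraph m n) m (vset m n (fun j => i + 3 ≤ j) (fun j _ => i ≤ j)) := by
  -- The only neighbour of `f_i^k` is `f_{i+1}^k`, which is also adjacent to `f_{i+2}^k`. Removing
  -- layer `i + 2` isolates the `m` edges between layers `i` and `i + 1`.
  refine IndepGood.of_dominated (D := vset m n (fun _ => False) (fun j _ => j = i + 2)) ?_ ?_ ?_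
  · rintro (l | ⟨l, k⟩) hl <;> simp at hl ⊢; omega
  · rintro (l | ⟨l, k⟩) hl
    · simp at hl
    refine ⟨f i (by omega) k, by simp [f], by simp [f], ?_⟩
    rintro (l' | ⟨l', k'⟩) hl' <;> simp [f] at hl hl' ⊢ <;> omega
  · convert good_of_edges hi h using 1
    · omega
    · ext (l | ⟨l, k⟩) <;> simp; omega

/-- The complex on the vertices `f_j^k` with `j ≥ i` and `e_j` with `j ≥ i + 2`. -/
lemma good_link {i : ℕ} (hm : 0 < m) (hi : i + 1 < n)
    (h : i + 3 ≤ n → IndepGood (deltaGraph m n) 0 (tail m n (i + 3))) :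
    IndepGood (deltaGraph m n) m (vset m n (fun j => i + 2 ≤ j) (fun j _ => i ≤ j)) := by
  by_cases hn : i + 3 ≤ n
  · refine IndepGood.of_dominated
      (D := vset m n (fun j => j = i + 2) (fun j _ => j = i + 2)) ?_ ?_ ?_
    · rintro (l | ⟨l, k⟩) hl <;> simp at hl ⊢ <;> omega
    · rintro (l | ⟨l, k⟩) hl
      · refine ⟨f i hi ⟨0, hm⟩, by simp [f], by simp [f], ?_⟩
        rintro (l' | ⟨l', k'⟩) hl' <;> simp [f] at hl hl' ⊢ <;> omega
      · refine ⟨f i hi k, by simp [f], by simp [f], ?_⟩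
        rintro (l' | ⟨l', k'⟩) hl' <;> simp [f] at hl hl' ⊢ <;> omega
    · convert good_of_edges (by omega) (h hn) using 1
      · omega
      · ext (l | ⟨l, k⟩) <;> simp <;> omega
  -- Here `n = i + 2`: layer `i` is the last one and `f_i^0` is isolated.
  · refine indepGood_of_apex (u := f i hi ⟨0, hm⟩) (by simp [f]) ?_
    rintro (l | ⟨l, k⟩) hl <;> simp [f] at hl ⊢ <;> omega

/-- The link of `e_i` is contractible in the complement. -/
lemma null_link {i : ℕ} (hm : 0 < m) (hi : i + 2 < n) :
    IndepNull (deltaGraph m n) (vset m n (fun j => i + 3 ≤ j) (fun j _ => i + 1 ≤ j))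
      (vset m n (fun j => i + 3 ≤ j) (fun j _ => i ≤ j)) := by
  have hST : vset m n (fun j => i + 3 ≤ j) (fun j _ => i + 1 ≤ j) ⊆
      vset m n (fun j => i + 3 ≤ j) (fun j _ => i ≤ j) := by
    rintro (l | ⟨l, k⟩) hl <;> simp at hl ⊢ <;> omega
  by_cases hn : i + 3 < n
  -- An intermediate set, with layer `i` present and layer `i + 3` absent: the `f_i^k` dominate the
  -- `f_{i+2}^k`, and without these two layers `e_{i+3}` has no neighbours.
  · have hC : IndepNull (deltaGraph m n)
        (vset m n (fun j => i + 3 ≤ j) (fun j _ => i ≤ j ∧ j ≠ i + 3))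
        (vset m n (fun j => i + 3 ≤ j) (fun j _ => i ≤ j)) := by
      refine IndepNull.of_dominated ?_ (D := vset m n (fun _ => False) (fun j _ => j = i + 2))
        ?_ ?_ (IndepNull.of_apex (u := e m (i + 3) hn) ?_ ?_ ?_)
      · rintro (l | ⟨l, k⟩) hl <;> simp at hl ⊢ <;> omega
      · rintro (l | ⟨l, k⟩) hl <;> simp at hl ⊢; omega
      · rintro (l | ⟨l, k⟩) hl
        · simp at hl
        refine ⟨f i (by omega) k, by simp [f], by simp [f], ?_⟩
        rintro (l' | ⟨l', k'⟩) hl' <;> simp [f] at hl hl' ⊢ <;> omega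
      · rintro (l | ⟨l, k⟩) hl <;> simp at hl ⊢ <;> omega
      · simp [e]
      · rintro (l | ⟨l, k⟩) hl <;> simp [e] at hl ⊢; omega
    -- Within the link, `f_{i+1}^k` sees only `f_{i+2}^k`, so it dominates `f_{i+3}^k` and also
    -- `e_{i+3}`; what remains lies in the intermediate set.
    refine IndepNull.of_dominated hST (D := vset m n (fun j => j = i + 3) (fun j _ => j = i + 3))
      ?_ ?_ (hC.mono ?_ subset_rfl)
    · rintro (l | ⟨l, k⟩) hl <;> simp at hl ⊢ <;> omega
    · rintro (l | ⟨l, k⟩) hl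
      · refine ⟨f (i + 1) hi ⟨0, hm⟩, by simp [f], by simp [f], ?_⟩
        rintro (l' | ⟨l', k'⟩) hl' <;> simp [f] at hl hl' ⊢ <;> omega
      · refine ⟨f (i + 1) hi k, by simp [f], by simp [f], ?_⟩
        rintro (l' | ⟨l', k'⟩) hl' <;> simp [f] at hl hl' ⊢ <;> omega
    · rintro (l | ⟨l, k⟩) hl <;> simp at hl ⊢ <;> omega
  · refine IndepNull.of_apex hST (u := f (i + 1) hi ⟨0, hm⟩) (by simp [f]) ?_
    rintro (l | ⟨l, k⟩) hl <;> simp [f] at hl ⊢ <;> omega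

/-- The complex on the tail without `e_{i+1}` and `e_{i+2}`. -/
lemma good_middle {i : ℕ} (hm : 2 ≤ m) (hi : i + 2 < n)
    (h3 : IndepGood (deltaGraph m n) 0 (tail m n (i + 3)))
    (h4 : i + 4 ≤ n → IndepGood (deltaGraph m n) 0 (tail m n (i + 4))) :
    IndepGood (deltaGraph m n) 2
      (vset m n (fun j => j = i ∨ i + 3 ≤ j) (fun j _ => i ≤ j)) := by
  set S := vset m n (fun j => j = i ∨ i + 3 ≤ j) (fun j _ => i ≤ j) with hS
  have hA : S \ {e m i (by omega)} = vset m n (fun j => i + 3 ≤ j) (fun j _ => i ≤ j) := by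
    ext (l | ⟨l, k⟩) <;> simp [hS, e, Fin.ext_iff]; omega
  have hL : (deltaGraph m n).indepLink S (e m i (by omega)) =
      vset m n (fun j => i + 3 ≤ j) (fun j _ => i + 1 ≤ j) := by
    ext (l | ⟨l, k⟩) <;> simp [hS, indepLink, e, Fin.ext_iff] <;> omega
  refine IndepGood.of_link (v := e m i (by omega)) (by simp [hS, e]) ?_ ?_ ?_
  · rw [hA]; exact (good_deletion hi h3).mono hm
  · rw [hL]; exact (good_link (i := i + 1) (by omega) (by omega) h4).mono (by omega)
  · rw [hL, hA]; exact null_link (by omega) hi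

/-- The link of `e_{i+2}` is contractible in the complement. -/
lemma null_star {i : ℕ} (hm : 2 ≤ m) (hi : i + 2 < n) :
    IndepNull (deltaGraph m n)
      (vset m n (fun j => j = i ∨ i + 3 ≤ j) (fun j _ => j = i ∨ i + 3 ≤ j))
      (vset m n (fun j => j = i ∨ i + 3 ≤ j) (fun j _ => i ≤ j)) := by
  -- All `f_i^k` are interchangeable here. Keeping only strand 1 leaves `f_{i+1}^0`, on strand 0,
  -- without neighbours, and it belongs to the larger set.
  refine IndepNull.of_dominated ?_ (D := vset m n (fun _ => False) (fun j k => j = i ∧ k ≠ 1))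
    ?_ ?_ (IndepNull.of_apex (u := f (i + 1) hi ⟨0, by omega⟩) ?_ ?_ ?_)
  · rintro (l | ⟨l, k⟩) hl <;> simp at hl ⊢ <;> omega
  · rintro (l | ⟨l, k⟩) hl <;> simp at hl ⊢; omega
  · rintro (l | ⟨l, k⟩) hl
    · simp at hl
    refine ⟨f i (by omega) ⟨1, hm⟩, by simp [f], by simp [f], ?_⟩
    rintro (l' | ⟨l', k'⟩) hl' <;> simp [f] at hl hl' ⊢ <;> omega
  · rintro (l | ⟨l, k⟩) hl <;> simp at hl ⊢ <;> omega
  · simp [f]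
  · rintro (l | ⟨l, k⟩) hl <;> simp [f, Fin.ext_iff] at hl ⊢ <;> omega

/-- The tail without `e_{i+1}`. -/
lemma good_tail_of_reduced {i : ℕ} (hi : i + 1 < n) {c : ℕ}
    (h : IndepGood (deltaGraph m n) c
      (vset m n (fun j => j = i ∨ i + 2 ≤ j) (fun j _ => i ≤ j))) :
    IndepGood (deltaGraph m n) c (tail m n i) := by
  refine IndepGood.of_dominated (D := vset m n (fun j => j = i + 1) (fun _ _ => False)) ?_ ?_ ?_
  · rintro (l | ⟨l, k⟩) hl <;> simp [tail] at hl ⊢; omega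
  · rintro (l | ⟨l, k⟩) hl
    -- In the tail `e_i` sees only layer `i`, all of which is adjacent to `e_{i+1}`.
    · refine ⟨e m i (by omega), by simp [e, tail], by simp [e], ?_⟩
      rintro (l' | ⟨l', k'⟩) hl' <;> simp [e, tail] at hl hl' ⊢; omega
    · simp at hl
  · convert h using 1
    ext (l | ⟨l, k⟩) <;> simp [tail]; omega

/-- Downward induction relying on the tails from `i + 3` and `i + 4`. The bound 0 is the one valid
for all tails, since the last one is empty; the suspensions regain the bounds needed for
connectedness. -/
lemma good_tail (hm : 2 ≤ m) (i : ℕ) (hi : i ≤ n) :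
    IndepGood (deltaGraph m n) 0 (tail m n i) := by
  induction i using Nat.strong_decreasing_induction with
  | base => exact ⟨n, fun j hj hj' => by omega⟩
  | step i ih =>
    have hempty : ∀ j, n ≤ j → IndepGood (deltaGraph m n) 0 (tail m n j) := fun j hj => by
      convert indepGood_empty (G := deltaGraph m n)
      ext (l | ⟨l, k⟩) <;> simp [tail] <;> omega
    rcases (by omega : n ≤ i ∨ i + 1 = n ∨ i + 2 = n ∨ i + 3 ≤ n) with h | h | h | h
    · exact hempty i h
    · refine indepGood_of_apex (u := e m i (by omega)) (by simp [e, tail]) ?_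
      rintro (l | ⟨l, k⟩) hl <;> simp [e, tail] at hl ⊢; omega
    · refine good_tail_of_reduced (by omega) ?_
      convert (good_star (by omega) (by omega : i + 1 < n) (hempty _ (by omega))).mono
        (Nat.zero_le 1) using 1
      ext (l | ⟨l, k⟩) <;> simp <;> omega
    · refine good_tail_of_reduced (by omega) ?_
      set S := vset m n (fun j => j = i ∨ i + 2 ≤ j) (fun j _ => i ≤ j) with hS
      have hA : S \ {e m (i + 2) (by omega)} =
          vset m n (fun j => j = i ∨ i + 3 ≤ j) (fun j _ => i ≤ j) := by
        ext (l | ⟨l, k⟩) <;> simp [hS, e, Fin.ext_iff]; omega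
      have hL : (deltaGraph m n).indepLink S (e m (i + 2) (by omega)) =
          vset m n (fun j => j = i ∨ i + 3 ≤ j) (fun j _ => j = i ∨ i + 3 ≤ j) := by
        ext (l | ⟨l, k⟩) <;> simp [hS, indepLink, e, Fin.ext_iff] <;> omega
      have h3 := ih (i + 3) (by omega) h
      have : IndepGood (deltaGraph m n) 2 S := by
        refine IndepGood.of_link (v := e m (i + 2) (by omega)) (by simp [hS, e]) ?_ ?_ ?_
        · rw [hA]; exact good_middle hm (by omega) h3 fun h4 => ih (i + 4) (by omega) h4
        · rw [hL]; exact good_star (by omega) (by omega) h3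
        · rw [hL, hA]; exact null_star hm (by omega)
      exact this.mono (by omega)

end DeltaGraph

/-! ### The result for `Δ^m_n` -/

open SimpleGraph CategoryTheory

lemma IsHomotopyWedgeOfSpheres.of_homotopyEquiv {X Y : Type} [TopologicalSpace X]
    [TopologicalSpace Y] (h : IsHomotopyWedgeOfSpheres Y) (e : X ≃ₕ Y) :
    IsHomotopyWedgeOfSpheres X := by
  obtain ⟨k, d, ⟨e'⟩⟩ := h
  exact ⟨k, d, ⟨e.trans e'⟩⟩

/-- The support of a point is the simplex that carries it, and the products `x u * x v` vanish along
edges exactly when this support is independent. -/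
lemma SimpleGraph.realization_independenceComplex {V : Type} [Fintype V] (G : SimpleGraph V) :
    G.independenceComplex.realization = G.indepReal Set.univ := by
  classical
  ext x
  constructor
  · rintro ⟨h0, s, hs, hx, hsum⟩
    refine ⟨h0, ?_, fun v hv => (hv (Set.mem_univ v)).elim, fun u v huv => ?_⟩
    · rw [← hsum]
      exact (Finset.sum_subset (Finset.subset_univ s) fun v _ hv => hx v hv).symm
    · by_cases hu : u ∈ s
      · by_cases hv : v ∈ s
        · exact (hs.2 hu hv huv.ne huv).elim
        · rw [hx v hv, mul_zero]
      · rw [hx u hu, zero_mul]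
  · rintro ⟨h0, hsum, -, hadj⟩
    have hsupp : ∑ v ∈ Finset.univ.filter (fun v => x v ≠ 0), x v = 1 := by
      rw [← hsum]; exact Finset.sum_filter_ne_zero _
    refine ⟨h0, Finset.univ.filter fun v => x v ≠ 0, ⟨?_, ?_⟩, fun v hv => by simpa using hv, hsupp⟩
    · by_contra hne
      rw [Finset.not_nonempty_iff_eq_empty] at hne
      rw [hne, Finset.sum_empty] at hsupp
      exact zero_ne_one hsupp
    · intro u hu v hv _ huv
      simp only [Finset.coe_filter, Finset.mem_univ, true_and, Set.mem_ofPred_eq] at hu hv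
      exact mul_ne_zero hu hv (hadj u v huv)

theorem deltaGraph_independenceComplex {m n : ℕ} (hm : 2 ≤ m) (hn : 1 ≤ n) :
    IsHomotopyWedgeOfSpheres (deltaGraph m n).independenceComplex.realization ∧
      ∀ q : ℕ, Module.IsTorsionFree ℤ ((deltaGraph m n).independenceComplex.integralHomology q) := by
  have h := DeltaGraph.good_tail hm 0 (Nat.zero_le n)
  have ht : DeltaGraph.tail m n 0 = Set.univ := by
    ext (l | ⟨l, k⟩) <;> simp [DeltaGraph.tail]
  rw [ht] at h
  refine ⟨?_, isTorsionFree_integralHomology h.1⟩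
  rw [realization_independenceComplex]
  refine (h.2.resolve_left fun e => ?_).isHomotopyWedgeOfSpheres
  exact Set.eq_empty_iff_forall_notMem.1 e.2 (Sum.inl ⟨0, hn⟩) (Set.mem_univ _)

/-! ### Invariance under isomorphisms of simplicial complexes -/

namespace AbstractSimplicialComplex

variable {V W : Type} {K : AbstractSimplicialComplex V} {L : AbstractSimplicialComplex W}

/-- The map of simplicial sets induced by a simplicial map. -/
def orderedSimplicesMap (g : V → W) (hg : ∀ s ∈ K.faces, ∃ t ∈ L.faces, ∀ v ∈ s, g v ∈ t) :
    K.orderedSimplices ⟶ L.orderedSimplices where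
  app q := TypeCat.ofHom fun f => ⟨fun i => g (f.1 i), by
    obtain ⟨s, hs, h⟩ := f.2
    obtain ⟨t, ht, h'⟩ := hg s hs
    exact ⟨t, ht, fun i => h' _ (h i)⟩⟩

/-- An isomorphism of simplicial complexes induces one of simplicial sets. -/
def orderedSimplicesIso (e : V ≃ W) (h : ∀ s ∈ K.faces, ∃ t ∈ L.faces, ∀ v ∈ s, e v ∈ t)
    (h' : ∀ t ∈ L.faces, ∃ s ∈ K.faces, ∀ v ∈ t, e.symm v ∈ s) :
    K.orderedSimplices ≅ L.orderedSimplices where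
  hom := orderedSimplicesMap e h
  inv := orderedSimplicesMap e.symm h'
  hom_inv_id := by
    ext q x
    exact Subtype.ext (funext fun i => e.symm_apply_apply (x.1 i))
  inv_hom_id := by
    ext q x
    exact Subtype.ext (funext fun i => e.apply_symm_apply (x.1 i))

lemma isTorsionFree_integralHomology_of_equiv (e : V ≃ W)
    (h : ∀ s ∈ K.faces, ∃ t ∈ L.faces, ∀ v ∈ s, e v ∈ t)
    (h' : ∀ t ∈ L.faces, ∃ s ∈ K.faces, ∀ v ∈ t, e.symm v ∈ s) (q : ℕ)
    [Module.IsTorsionFree ℤ (L.integralHomology q)] :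
    Module.IsTorsionFree ℤ (K.integralHomology q) := by
  let φ : K.integralHomology q ≅ L.integralHomology q :=
    (SSet.homologyFunctor (ModuleCat.of ℤ ℤ) q).mapIso (orderedSimplicesIso e h h')
  exact φ.toLinearEquiv.injective.moduleIsTorsionFree _ φ.toLinearEquiv.map_smul

/-- An isomorphism of simplicial complexes induces a homeomorphism of realizations. -/
def realizationHomeomorph [Finite V] [Finite W] (e : V ≃ W)
    (h : ∀ s, s ∈ K.faces ↔ s.map e.toEmbedding ∈ L.faces) : K.realization ≃ₜ L.realization where
  toFun x := ⟨fun w => x.1 (e.symm w), fun w => x.2.1 _, by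
    obtain ⟨s, hs, hx, hsum⟩ := x.2.2
    refine ⟨_, (h s).1 hs, fun w hw => hx _ fun hw' => hw ?_, by simpa using hsum⟩
    exact Finset.mem_map.2 ⟨_, hw', e.apply_symm_apply w⟩⟩
  invFun x := ⟨fun v => x.1 (e v), fun w => x.2.1 _, by
    obtain ⟨t, ht, hx, hsum⟩ := x.2.2
    have hmap : (t.map e.symm.toEmbedding).map e.toEmbedding = t := by
      ext w; simp
    refine ⟨t.map e.symm.toEmbedding, (h _).2 (hmap.symm ▸ ht), fun v hv => hx _ fun hv' => hv ?_,
      by simpa using hsum⟩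
    exact Finset.mem_map.2 ⟨_, hv', e.symm_apply_apply v⟩⟩
  left_inv x := Subtype.ext (funext fun v => by simp)
  right_inv x := Subtype.ext (funext fun v => by simp)
  continuous_toFun := by
    refine Continuous.subtype_mk (continuous_pi fun w => ?_) _
    exact (continuous_apply (A := fun _ : V => ℝ) (e.symm w)).comp continuous_subtype_val
  continuous_invFun := by
    refine Continuous.subtype_mk (continuous_pi fun v => ?_) _
    exact (continuous_apply (A := fun _ : W => ℝ) (e v)).comp continuous_subtype_val

end AbstractSimplicialComplex

/-! ### The ladder and its line graph -/

namespace GridGraph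

/-- The edge of the `n × 2` grid that corresponds to a vertex of `Δ^2_n`. -/
def edge (n : ℕ) : Fin n ⊕ (Fin (n - 1) × Fin 2) → (gridGraph n 2).edgeSet
  | Sum.inl i => ⟨s((i, 0), (i, 1)), by
      change |_| + |_| = _
      simp⟩
  | Sum.inr (i, k) => ⟨s((⟨i, by omega⟩, k), (⟨i + 1, by omega⟩, k)), by
      change |_| + |_| = _
      simp⟩

lemma mem_edge_inl {n : ℕ} (i : Fin n) (p : Fin n × Fin 2) :
    p ∈ (edge n (Sum.inl i) : Sym2 (Fin n × Fin 2)) ↔ p.1 = i := by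
  obtain ⟨a, b⟩ := p
  simp only [edge, Sym2.mem_iff, Prod.mk.injEq]
  fin_cases b <;> simp

lemma mem_edge_inr {n : ℕ} (i : Fin (n - 1)) (k : Fin 2) (p : Fin n × Fin 2) :
    p ∈ (edge n (Sum.inr (i, k)) : Sym2 (Fin n × Fin 2)) ↔
      p.2 = k ∧ ((p.1 : ℕ) = i ∨ (p.1 : ℕ) = i + 1) := by
  obtain ⟨a, b⟩ := p
  simp only [edge, Sym2.mem_iff, Prod.mk.injEq, Fin.ext_iff]
  tauto

/-- The `e_i` are the rungs and the `f_i^k` the rail edges; sharing an endpoint in the ladder is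
adjacency in `Δ^2_n`. -/
lemma exists_mem_edge_iff {n : ℕ} {x y : Fin n ⊕ (Fin (n - 1) × Fin 2)} (hxy : x ≠ y) :
    (∃ p, p ∈ (edge n x : Sym2 (Fin n × Fin 2)) ∧ p ∈ (edge n y : Sym2 (Fin n × Fin 2))) ↔
      (deltaGraph 2 n).Adj x y := by
  rcases x with i | ⟨i, k⟩ <;> rcases y with j | ⟨j, l⟩
  · simp only [mem_edge_inl, DeltaGraph.adj_inl_inl, iff_false]
    rintro ⟨p, rfl, rfl⟩
    exact hxy rfl
  · simp only [mem_edge_inl, mem_edge_inr, DeltaGraph.adj_inl_inr]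
    constructor
    · rintro ⟨p, rfl, rfl, h⟩; exact h
    · intro h; exact ⟨(i, l), rfl, rfl, h⟩
  · simp only [mem_edge_inl, mem_edge_inr, DeltaGraph.adj_inr_inl]
    constructor
    · rintro ⟨p, ⟨rfl, h⟩, rfl⟩; exact h
    · intro h; exact ⟨(j, k), ⟨rfl, h⟩, rfl⟩
  · simp only [mem_edge_inr, DeltaGraph.adj_inr_inr]
    have hne : ¬ (k = l ∧ (i : ℕ) = j) := fun h => hxy (by
      obtain ⟨rfl, h⟩ := h; rw [Fin.ext h])
    constructor
    · rintro ⟨p, ⟨rfl, h⟩, rfl, h'⟩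
      refine ⟨rfl, ?_⟩
      have : (i : ℕ) ≠ j := fun e => hne ⟨rfl, e⟩
      omega
    · rintro ⟨rfl, h | h⟩
      · exact ⟨(⟨j, by omega⟩, k), ⟨rfl, Or.inr h⟩, rfl, Or.inl rfl⟩
      · exact ⟨(⟨i, by omega⟩, k), ⟨rfl, Or.inl rfl⟩, rfl, Or.inr h⟩

lemma edge_injective (n : ℕ) : Function.Injective (edge n) := by
  rintro (i | ⟨i, k⟩) (j | ⟨j, l⟩) h
  · have := (mem_edge_inl j (i, 0)).1 (h ▸ (mem_edge_inl i (i, 0)).2 rfl)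
    exact congrArg _ this
  · have h0 := (mem_edge_inr j l (i, 0)).1 (h ▸ (mem_edge_inl i (i, 0)).2 rfl)
    have h1 := (mem_edge_inr j l (i, 1)).1 (h ▸ (mem_edge_inl i (i, 1)).2 rfl)
    exact (zero_ne_one (h0.1.trans h1.1.symm)).elim
  · have h0 := (mem_edge_inr i k (j, 0)).1 (h ▸ (mem_edge_inl j (j, 0)).2 rfl)
    have h1 := (mem_edge_inr i k (j, 1)).1 (h ▸ (mem_edge_inl j (j, 1)).2 rfl)
    exact (zero_ne_one (h0.1.trans h1.1.symm)).elim
  · have h0 := (mem_edge_inr j l (⟨i, by omega⟩, k)).1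
      (h ▸ (mem_edge_inr i k _).2 ⟨rfl, Or.inl rfl⟩)
    have h1 := (mem_edge_inr j l (⟨i + 1, by omega⟩, k)).1
      (h ▸ (mem_edge_inr i k _).2 ⟨rfl, Or.inr rfl⟩)
    obtain ⟨rfl, h0⟩ := h0
    have h1 := h1.2
    obtain rfl : i = j := Fin.ext (by simp only at h0 h1; omega)
    rfl

lemma edge_surjective (n : ℕ) : Function.Surjective (edge n) := by
  rintro ⟨z, hz⟩
  induction z with
  | h p r =>
  obtain ⟨a, b⟩ := p
  obtain ⟨c, d⟩ := r
  have h : |((c : ℕ) : ℤ) - ((a : ℕ) : ℤ)| + |((d : ℕ) : ℤ) - ((b : ℕ) : ℤ)| = 1 := hz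
  have hb := b.2
  have hd := d.2
  have cases : (a = c ∧ b = 0 ∧ d = 1) ∨ (a = c ∧ b = 1 ∧ d = 0) ∨
      (b = d ∧ (c : ℕ) = a + 1) ∨ (b = d ∧ (a : ℕ) = c + 1) := by
    simp only [Fin.ext_iff, Fin.val_zero, Fin.val_one]
    rcases abs_cases (((c : ℕ) : ℤ) - ((a : ℕ) : ℤ)) with h1 | h1 <;>
      rcases abs_cases (((d : ℕ) : ℤ) - ((b : ℕ) : ℤ)) with h2 | h2 <;> omega
  rcases cases with ⟨rfl, rfl, rfl⟩ | ⟨rfl, rfl, rfl⟩ | ⟨rfl, hc⟩ | ⟨rfl, hc⟩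
  · exact ⟨Sum.inl a, rfl⟩
  · exact ⟨Sum.inl a, Subtype.ext Sym2.eq_swap⟩
  · refine ⟨Sum.inr (⟨a, by omega⟩, b), Subtype.ext ?_⟩
    exact Sym2.eq_iff.2 (Or.inl ⟨rfl, Prod.ext (Fin.ext hc.symm) rfl⟩)
  · refine ⟨Sum.inr (⟨c, by omega⟩, b), Subtype.ext ?_⟩
    refine Eq.trans ?_ Sym2.eq_swap
    exact Sym2.eq_iff.2 (Or.inl ⟨rfl, Prod.ext (Fin.ext hc.symm) rfl⟩)

/-- The line graph of the `n × 2` grid is `Δ^2_n`. -/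
noncomputable def edgeEquiv (n : ℕ) : Fin n ⊕ (Fin (n - 1) × Fin 2) ≃ (gridGraph n 2).edgeSet :=
  Equiv.ofBijective (edge n) ⟨edge_injective n, edge_surjective n⟩

/-- Matchings are the independent sets of the line graph. -/
lemma mem_faces_iff (n : ℕ) (s : Finset (Fin n ⊕ (Fin (n - 1) × Fin 2))) :
    s ∈ (deltaGraph 2 n).independenceComplex.faces ↔
      s.map (edgeEquiv n).toEmbedding ∈ (gridGraph n 2).matchingComplex.faces := by
  change (s.Nonempty ∧ _) ↔ (Finset.Nonempty _ ∧ _)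
  refine and_congr (by simp) ⟨fun h p => ?_, fun h => ?_⟩
  · rintro _ ⟨hx, hpx⟩ _ ⟨hy, hpy⟩
    obtain ⟨x, hxs, rfl⟩ := Finset.mem_map.1 hx
    obtain ⟨y, hys, rfl⟩ := Finset.mem_map.1 hy
    by_contra hne
    have hxy : x ≠ y := fun e => hne (congrArg _ e)
    exact h hxs hys hxy ((exists_mem_edge_iff hxy).1 ⟨p, hpx, hpy⟩)
  · intro x hx y hy hxy hadj
    obtain ⟨p, hpx, hpy⟩ := (exists_mem_edge_iff hxy).2 hadj
    exact hxy ((edgeEquiv n).injective (h p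
      ⟨Finset.mem_coe.2 (Finset.mem_map.2 ⟨x, hx, rfl⟩), hpx⟩
      ⟨Finset.mem_coe.2 (Finset.mem_map.2 ⟨y, hy, rfl⟩), hpy⟩))

end GridGraph

theorem mainTheorem4 :
    (∀ m n : ℕ, 2 ≤ m → 1 ≤ n →
      IsHomotopyWedgeOfSpheres (deltaGraph m n).independenceComplex.realization ∧
      ∀ q : ℕ, Module.IsTorsionFree ℤ ((deltaGraph m n).independenceComplex.integralHomology q)) ∧
    (∀ n : ℕ, 1 ≤ n →
      IsHomotopyWedgeOfSpheres (gridGraph n 2).matchingComplex.realization ∧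
      ∀ q : ℕ, Module.IsTorsionFree ℤ ((gridGraph n 2).matchingComplex.integralHomology q)) := by
  refine ⟨fun m n hm hn => deltaGraph_independenceComplex hm hn, fun n hn => ?_⟩
  obtain ⟨h1, h2⟩ := deltaGraph_independenceComplex le_rfl hn
  have hf := GridGraph.mem_faces_iff n
  refine ⟨h1.of_homotopyEquiv (AbstractSimplicialComplex.realizationHomeomorph
    (GridGraph.edgeEquiv n) hf).symm.toHomotopyEquiv, fun q => ?_⟩
  have := h2 q
  refine AbstractSimplicialComplex.isTorsionFree_integralHomology_of_equiv
    (L := (deltaGraph 2 n).independenceComplex) (GridGraph.edgeEquiv n).symm ?_ ?_ q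
  · intro t ht
    refine ⟨t.map (GridGraph.edgeEquiv n).symm.toEmbedding, (hf _).2 ?_, fun v hv => by simpa⟩
    convert ht
    ext w; simp
  · exact fun s hs => ⟨_, (hf s).1 hs, fun v hv => by simpa⟩
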